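/- For $f\in L^2(\mathbb{R})$ let $\hat f(\xi)=\int_{\mathbb{R}}e^{-ix\xi}f(x)\,dx$ denote the Fourier transform (extended to $L^2(\mathbb{R})$ by continuity), and for $a>0$ and $t\in\mathbb{R}$ put $$S_tf(x)=\frac1{2\pi}\int_{\mathbb{R}}e^{i\xi x}\,e^{it|\xi|^a}\,\hat f(\xi)\,d\xi,\qquad x\in\mathbb{R},$$ where the integral converges absolutely if $\hat f$ has compact support. Theorem. Let $a>0$ and $a\neq1$. There is a constant $C>0$, depending only on $a$, such that for every $\lambda\ge1$, every interval $J\subset[0,1]$ with length $|J|$, and every $f\in L^2(\mathbb{R})$ with $\operatorname{supp}\hat f\subset\{\xi\in\mathbb{R}:|\xi|\le\lambda\}$, one has $$\Bigl\|\sup_{t\in J}|S_tf|\Bigr\|_{L^2(\mathbb{R})}\le C\left(|J|^{1/4}\lambda^{a/4}+1\right)\|f\|_{L^2(\mathbb{R})}.$$ -/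

import Mathlib

open MeasureTheory Set
open scoped FourierTransform ENNReal Topology

noncomputable section

/-- The Fourier transform on `L²(ℝ)` with the normalization `f̂(ξ) = ∫ e^{-i x ξ} f(x) dx`, i.e. the
unique continuous extension of this integral from nice functions to `L²(ℝ)`.  Mathlib's (Plancherel)
transform `𝓕` on `L²` uses the kernel `e^{-2π i x η}`, whence the substitution `η = ξ / (2π)`. The
value is a representative of an almost-everywhere class. -/
def fourierHat (f : Lp ℂ 2 (volume : Measure ℝ)) (ξ : ℝ) : ℂ :=
  (𝓕 f : Lp ℂ 2 (volume : Measure ℝ)) (ξ / (2 * Real.pi))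

/-- The support of an almost-everywhere class of functions on `ℝ`: the complement of the largest open
set on which the function vanishes almost everywhere. -/
def essSupp (g : ℝ → ℂ) : Set ℝ :=
  {ξ | ∀ U ∈ 𝓝 ξ, ¬ ∀ᵐ η ∂(volume.restrict U), g η = 0}

/-- The Schrödinger means
`S_t f(x) = (2π)⁻¹ ∫ e^{i ξ x} e^{i t |ξ|^a} f̂(ξ) dξ` in dimension one.  The integral converges
absolutely whenever `f̂` is compactly supported. -/
def schrodingerMean (a t : ℝ) (f : Lp ℂ 2 (volume : Measure ℝ)) (x : ℝ) : ℂ :=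
  (2 * (Real.pi : ℂ))⁻¹ *
    ∫ ξ : ℝ, Complex.exp (Complex.I * ((ξ * x : ℝ) : ℂ)) *
      Complex.exp (Complex.I * ((t * |ξ| ^ a : ℝ) : ℂ)) * fourierHat f ξ

/-- The maximal function `x ↦ sup_{t ∈ J} |S_t f(x)|`, with values in `[0, ∞]`. -/
def schrodingerMaximal (a : ℝ) (J : Set ℝ) (f : Lp ℂ 2 (volume : Measure ℝ)) (x : ℝ) : ℝ≥0∞ :=
  ⨆ t ∈ J, ‖schrodingerMean a t f x‖ₑ

end

/-!
The maximal function is estimated on the frequency side, for `g = f̂` supported in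
`|ξ| ≤ lam`, with `M = |J| lam ^ a`, the length of `J` measured in periods of the fastest waves.

If `M ≤ 1`, the supremum over `J` costs only a constant: by the fundamental theorem of calculus it
is at most the value at one time plus the integral over `J` of the time derivative, which has `L²`
norm at most a multiple of `lam ^ a ‖g‖` (`eLpNorm_waveSup_le_of_mul_rpow_le_one`).

If `M ≥ 1` and `g` lives on the annulus `lam / 2 ≤ |ξ| ≤ lam`, the supremum is linearised by a
measurable choice `τ x ∈ J` of the time, and the linear operator `T g (x) = waveInt a (τ x) g x`
is treated by the `T T*` method (`lintegral_waveInt_sq_le`). After the multiplier of the annulus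
is smoothed, the kernel of `T T*` is an oscillatory integral with phase `ξ (x - y) + (τ x - τ y)
|ξ|^a`. In units of `lam⁻¹`, it decays like `|x - y|^{-1/2}` by van der Corput's second derivative
test, which needs `a ≠ 1`, and like `|x - y|^{-2}` beyond a multiple of `M`, where the phase is
not stationary (`exists_norm_bumpInt_le`). It is thus dominated by a convolution kernel of
integral `O(M ^ (1/2))`, and Schur's test gives `‖T‖ = O(M ^ (1/4))`
(`exists_eLpNorm_waveSup_le_annulus`).

A general `g` is the sum of a part with `M ≤ 1` and of finitely many annuli with `M ≥ 1`, whose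
bounds form a geometric series dominated by the top frequency (`exists_eLpNorm_waveSup_le`).
Plancherel's theorem returns from `f̂` to `f`. -/

/-! ### Plane waves and the `T T*` method -/

/-- The plane wave `e^{i ξ x} e^{i t |ξ|^a}`, the solution at time `t` and position `x` with
frequency `ξ`. -/
noncomputable def wave (a t x ξ : ℝ) : ℂ :=
  Complex.exp (Complex.I * ((ξ * x : ℝ) : ℂ)) * Complex.exp (Complex.I * ((t * |ξ| ^ a : ℝ) : ℂ))

/-- The superposition `∫ e^{i ξ x} e^{i t |ξ|^a} g(ξ) dξ` of plane waves with density `g` on the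
frequency side, without the factor `(2π)⁻¹`. -/
noncomputable def waveInt (a t : ℝ) (g : ℝ → ℂ) (x : ℝ) : ℂ := ∫ ξ, wave a t x ξ * g ξ

theorem wave_eq_exp (a t x ξ : ℝ) :
    wave a t x ξ = Complex.exp (Complex.I * ((ξ * x + t * |ξ| ^ a : ℝ) : ℂ)) := by
  rw [wave, ← Complex.exp_add]; push_cast; ring_nf

theorem norm_wave (a t x ξ : ℝ) : ‖wave a t x ξ‖ = 1 := by
  rw [wave_eq_exp, mul_comm, Complex.norm_exp_ofReal_mul_I]

theorem continuous_wave {a : ℝ} (ha : 0 < a) :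
    Continuous fun p : ℝ × ℝ × ℝ ↦ wave a p.1 p.2.1 p.2.2 := by
  have : Continuous fun p : ℝ × ℝ × ℝ ↦ |p.2.2| ^ a :=
    Continuous.rpow_const (by fun_prop) fun _ ↦ Or.inr ha.le
  unfold wave
  fun_prop

/-- The composition law behind the `T T*` argument: only differences of times and positions survive,
which makes the kernel of `T T*` a function of `(t - s, x - y)`. -/
theorem wave_mul_conj (a t s x y ξ : ℝ) :
    wave a t x ξ * (starRingEnd ℂ) (wave a s y ξ) = wave a (t - s) (x - y) ξ := by
  simp only [wave_eq_exp, ← Complex.exp_conj, ← Complex.exp_add, map_mul, Complex.conj_I,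
    Complex.conj_ofReal]
  congr 1; push_cast; ring

theorem integrable_wave_mul {a : ℝ} (ha : 0 < a) {g : ℝ → ℂ} (hg : Integrable g) (t x : ℝ) :
    Integrable fun ξ ↦ wave a t x ξ * g ξ := by
  refine hg.bdd_mul (c := 1) ?_ (.of_forall fun ξ ↦ (norm_wave ..).le)
  exact ((continuous_wave ha).comp
    (by fun_prop : Continuous fun ξ : ℝ ↦ (t, x, ξ))).aestronglyMeasurable

theorem norm_waveInt_le (a t : ℝ) (g : ℝ → ℂ) (x : ℝ) : ‖waveInt a t g x‖ ≤ ∫ ξ, ‖g ξ‖ := by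
  refine (norm_integral_le_integral_norm _).trans_eq ?_
  simp only [norm_mul, norm_wave, one_mul]

theorem continuous_waveInt {a : ℝ} (ha : 0 < a) {g : ℝ → ℂ} (hg : Integrable g) :
    Continuous fun p : ℝ × ℝ ↦ waveInt a p.1 g p.2 := by
  refine continuous_of_dominated (bound := fun ξ ↦ ‖g ξ‖)
    (fun p ↦ (integrable_wave_mul ha hg p.1 p.2).aestronglyMeasurable)
    (fun p ↦ .of_forall fun ξ ↦ by simp [norm_wave]) hg.norm
    (.of_forall fun ξ ↦ ?_)
  exact ((continuous_wave ha).comp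
    (by fun_prop : Continuous fun p : ℝ × ℝ ↦ (p.1, p.2, ξ))).mul continuous_const

theorem measurable_waveInt_comp {a : ℝ} (ha : 0 < a) {g : ℝ → ℂ} (hg : Integrable g) {τ : ℝ → ℝ}
    (hτ : Measurable τ) : Measurable fun x ↦ waveInt a (τ x) g x := by
  have h1 : Measurable fun x ↦ (τ x, x) := by fun_prop
  have h2 := (continuous_waveInt ha hg).measurable.comp h1
  simpa only [Function.comp_def] using h2

theorem ENNReal.two_mul_mul_le_sq_add_sq (u v : ℝ≥0∞) : 2 * (u * v) ≤ u ^ 2 + v ^ 2 := by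
  induction u with
  | top => simp
  | coe u =>
    induction v with
    | top => simp
    | coe v =>
      have h := two_mul_le_add_sq u v
      rw [mul_assoc] at h
      exact_mod_cast h

/-- Schur's test, as a quadratic form: an even kernel `G (x - y)` acts on `L²` with norm at most
`∫ G`. -/
theorem lintegral_schur {h : ℝ → ℂ} (hh : Measurable h) {G : ℝ → ℝ≥0∞} (hG : Measurable G)
    (hGe : ∀ x, G (-x) = G x) :
    ∫⁻ x, ∫⁻ y, ‖h x‖ₑ * ‖h y‖ₑ * G (x - y) ≤ (∫⁻ x, G x) * ∫⁻ x, ‖h x‖ₑ ^ 2 := by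
  have h1 : ∫⁻ x, ∫⁻ y, ‖h x‖ₑ ^ 2 * G (x - y) = (∫⁻ x, G x) * ∫⁻ x, ‖h x‖ₑ ^ 2 := by
    rw [← lintegral_const_mul _ (by fun_prop)]
    refine lintegral_congr fun x ↦ ?_
    rw [lintegral_const_mul _ (by fun_prop), lintegral_sub_left_eq_self G x, mul_comm]
  have h2 : ∫⁻ x, ∫⁻ y, ‖h y‖ₑ ^ 2 * G (x - y) = (∫⁻ x, G x) * ∫⁻ x, ‖h x‖ₑ ^ 2 := by
    rw [lintegral_lintegral_swap (by fun_prop), ← h1]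
    refine lintegral_congr fun x ↦ lintegral_congr fun y ↦ ?_
    rw [← hGe, neg_sub]
  have h3 : 2 * ∫⁻ x, ∫⁻ y, ‖h x‖ₑ * ‖h y‖ₑ * G (x - y) ≤
      2 * ((∫⁻ x, G x) * ∫⁻ x, ‖h x‖ₑ ^ 2) := by
    calc 2 * ∫⁻ x, ∫⁻ y, ‖h x‖ₑ * ‖h y‖ₑ * G (x - y)
        = ∫⁻ x, ∫⁻ y, 2 * (‖h x‖ₑ * ‖h y‖ₑ * G (x - y)) := by
          rw [← lintegral_const_mul' _ _ (by simp)]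
          exact lintegral_congr fun x ↦ (lintegral_const_mul' _ _ (by simp)).symm
      _ ≤ ∫⁻ x, ∫⁻ y, (‖h x‖ₑ ^ 2 * G (x - y) + ‖h y‖ₑ ^ 2 * G (x - y)) := by
          refine lintegral_mono fun x ↦ lintegral_mono fun y ↦ ?_
          rw [← add_mul, ← mul_assoc]
          gcongr
          exact ENNReal.two_mul_mul_le_sq_add_sq _ _
      _ = _ := by
          rw [two_mul]
          nth_rewrite 1 [← h1]
          rw [← h2, ← lintegral_add_left (by fun_prop)]
          exact lintegral_congr fun x ↦ lintegral_add_left (by fun_prop) _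
  exact (ENNReal.mul_le_mul_iff_right (by simp) (by simp)).1 h3

/-- The adjoint side of the `T T*` argument. The linearised operator is `g ↦ waveInt a (τ x) g x`,
and `ξ ↦ ∫ h(x) wave a (τ x) x ξ dx` is its transpose applied to `h`. Expanding the square of this
function and integrating it against the weight `w` first leaves the kernel `waveInt a (τ x - τ y) w`
at `x - y`, to which Schur's test applies. -/
theorem lintegral_weight_mul_adjoint_le {a : ℝ} (ha : 0 < a) {w : ℝ → ℝ} (hw0 : ∀ ξ, 0 ≤ w ξ)
    (hw : Integrable w) {G : ℝ → ℝ≥0∞} (hG : Measurable G) (hGe : ∀ x, G (-x) = G x)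
    {τ : ℝ → ℝ} (hτ : Measurable τ)
    (hK : ∀ x y, ‖waveInt a (τ x - τ y) (fun ξ ↦ (w ξ : ℂ)) (x - y)‖ₑ ≤ G (x - y))
    {h : ℝ → ℂ} (hm : Measurable h) (hh : Integrable h) :
    ∫⁻ ξ, ENNReal.ofReal (w ξ) * ‖∫ x, h x * wave a (τ x) x ξ‖ₑ ^ 2 ≤
      (∫⁻ x, G x) * ∫⁻ x, ‖h x‖ₑ ^ 2 := by
  have hwc : Integrable fun ξ ↦ (w ξ : ℂ) := hw.ofReal
  have hwave : Measurable fun p : ℝ × ℝ ↦ wave a (τ p.2) p.2 p.1 :=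
    (continuous_wave ha).measurable.comp
      (by fun_prop : Measurable fun p : ℝ × ℝ ↦ (τ p.2, p.2, p.1))
  set H : ℝ → ℂ := fun ξ ↦ ∫ x, h x * wave a (τ x) x ξ with hH
  have hHm : StronglyMeasurable H := by
    refine StronglyMeasurable.integral_prod_right (f := fun ξ x ↦ h x * wave a (τ x) x ξ) ?_
    exact ((hm.comp measurable_snd).mul hwave).stronglyMeasurable
  have hHb : ∀ ξ, ‖H ξ‖ ≤ ∫ x, ‖h x‖ := fun ξ ↦ by
    refine (norm_integral_le_integral_norm _).trans_eq ?_
    simp only [norm_mul, norm_wave, mul_one]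
  set F : ℝ → ℝ × ℝ → ℂ := fun ξ p ↦ (w ξ : ℂ) *
    ((h p.1 * wave a (τ p.1) p.1 ξ) * (starRingEnd ℂ) (h p.2 * wave a (τ p.2) p.2 ξ)) with hF
  have hFi : Integrable (Function.uncurry F) (volume.prod (volume.prod volume)) := by
    have hhc : Integrable fun x ↦ (starRingEnd ℂ) (h x) :=
      (Complex.conjLIE.integrable_comp_iff).2 hh
    have h0 := hwc.mul_prod (hh.mul_prod hhc)
    have h1 : Measurable fun p : ℝ × ℝ × ℝ ↦ wave a (τ p.2.1) p.2.1 p.1 *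
        (starRingEnd ℂ) (wave a (τ p.2.2) p.2.2 p.1) :=
      (hwave.comp (by fun_prop : Measurable fun p : ℝ × ℝ × ℝ ↦ (p.1, p.2.1))).mul
        (Complex.continuous_conj.measurable.comp
          (hwave.comp (by fun_prop : Measurable fun p : ℝ × ℝ × ℝ ↦ (p.1, p.2.2))))
    refine (h0.bdd_mul (c := 1) h1.aestronglyMeasurable (.of_forall fun p ↦ ?_)).congr
      (.of_forall fun p ↦ ?_)
    · simp [norm_wave]
    · simp only [hF, Function.uncurry, map_mul]; ring
  have hHsq : ∀ ξ, ∫ p, F ξ p ∂(volume.prod volume) = ((w ξ * ‖H ξ‖ ^ 2 : ℝ) : ℂ) := fun ξ ↦ by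
    simp only [hF]
    rw [integral_const_mul, integral_prod_mul (fun x ↦ h x * wave a (τ x) x ξ)
      (fun x ↦ (starRingEnd ℂ) (h x * wave a (τ x) x ξ)), integral_conj, Complex.mul_conj,
      Complex.normSq_eq_norm_sq]
    push_cast
    rfl
  have hint : Integrable fun ξ ↦ w ξ * ‖H ξ‖ ^ 2 := by
    refine hw.mul_bdd (c := (∫ x, ‖h x‖) ^ 2) (hHm.norm.pow 2).aestronglyMeasurable
      (.of_forall fun ξ ↦ ?_)
    rw [norm_pow, norm_norm]
    exact pow_le_pow_left₀ (norm_nonneg _) (hHb ξ) 2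
  calc ∫⁻ ξ, ENNReal.ofReal (w ξ) * ‖H ξ‖ₑ ^ 2
      = ∫⁻ ξ, ENNReal.ofReal (w ξ * ‖H ξ‖ ^ 2) := by
        refine lintegral_congr fun ξ ↦ ?_
        rw [ENNReal.ofReal_mul (hw0 ξ), ENNReal.ofReal_pow (norm_nonneg _), ofReal_norm]
    _ = ‖∫ ξ, ∫ p, F ξ p ∂(volume.prod volume)‖ₑ := by
        simp only [hHsq]
        rw [integral_complex_ofReal, ← ofReal_integral_eq_lintegral_ofReal hint
          (.of_forall fun ξ ↦ mul_nonneg (hw0 ξ) (sq_nonneg _)), ← ofReal_norm, Complex.norm_real,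
          Real.norm_of_nonneg (integral_nonneg fun ξ ↦ mul_nonneg (hw0 ξ) (sq_nonneg _))]
    _ = ‖∫ p, h p.1 * (starRingEnd ℂ) (h p.2) *
          waveInt a (τ p.1 - τ p.2) (fun ξ ↦ (w ξ : ℂ)) (p.1 - p.2) ∂(volume.prod volume)‖ₑ := by
        rw [integral_integral_swap hFi]
        congr 2 with p
        rw [waveInt, ← integral_const_mul]
        refine integral_congr_ae (.of_forall fun ξ ↦ ?_)
        simp only [hF, map_mul, ← wave_mul_conj]
        ring
    _ ≤ ∫⁻ p, ‖h p.1‖ₑ * ‖h p.2‖ₑ * G (p.1 - p.2) ∂(volume.prod volume) := by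
        refine (enorm_integral_le_lintegral_enorm _).trans (lintegral_mono fun p ↦ ?_)
        rw [enorm_mul, enorm_mul, RCLike.enorm_conj]
        gcongr
        exact hK _ _
    _ = ∫⁻ x, ∫⁻ y, ‖h x‖ₑ * ‖h y‖ₑ * G (x - y) := lintegral_prod _ (by fun_prop)
    _ ≤ _ := lintegral_schur hm hG hGe

/-- The `T T*` argument. If the weight `w` majorises the indicator of the support of `g` and the
kernels `waveInt a (τ x - τ y) w` are dominated by an even function of `x - y` with integral at most
`c`, then the linearised operator `g ↦ waveInt a (τ x) g x` has norm at most `√c` on such `g`. -/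
theorem lintegral_waveInt_sq_le {a : ℝ} (ha : 0 < a) {w : ℝ → ℝ} (hw0 : ∀ ξ, 0 ≤ w ξ)
    (hw : Integrable w) {G : ℝ → ℝ≥0∞} (hG : Measurable G) (hGe : ∀ x, G (-x) = G x)
    {τ : ℝ → ℝ} (hτ : Measurable τ)
    (hK : ∀ x y, ‖waveInt a (τ x - τ y) (fun ξ ↦ (w ξ : ℂ)) (x - y)‖ₑ ≤ G (x - y))
    {c : ℝ≥0∞} (hc : ∫⁻ x, G x ≤ c) (hc0 : c ≠ 0) (hct : c ≠ ∞)
    {g : ℝ → ℂ} (hg : Integrable g) (hgw : ∀ ξ, g ξ ≠ 0 → 1 ≤ w ξ) :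
    ∫⁻ x, ‖waveInt a (τ x) g x‖ₑ ^ 2 ≤ c * ∫⁻ ξ, ‖g ξ‖ₑ ^ 2 := by
  have hum : Measurable fun x ↦ waveInt a (τ x) g x :=
    measurable_waveInt_comp ha hg hτ
  have hwave : Measurable fun p : ℝ × ℝ ↦ wave a (τ p.1) p.1 p.2 :=
    (continuous_wave ha).measurable.comp
      (by fun_prop : Measurable fun p : ℝ × ℝ ↦ (τ p.1, p.1, p.2))
  have key : ∀ n : ℕ, ∫⁻ x in Metric.closedBall (0 : ℝ) n, ‖waveInt a (τ x) g x‖ₑ ^ 2 ≤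
      c * ∫⁻ ξ, ‖g ξ‖ₑ ^ 2 := fun n ↦ by
    -- Truncation to a ball makes `h` integrable and its `L²` norm finite, so that the latter can be
    -- cancelled below.
    set B := Metric.closedBall (0 : ℝ) n
    have hB : MeasurableSet B := Metric.isClosed_closedBall.measurableSet
    set h : ℝ → ℂ := B.indicator fun x ↦ (starRingEnd ℂ) (waveInt a (τ x) g x) with hh
    have hm : Measurable h := (Complex.continuous_conj.measurable.comp hum).indicator hB
    have hb : ∀ x, ‖h x‖ ≤ ∫ ξ, ‖g ξ‖ := fun x ↦ by
      rw [hh, norm_indicator_eq_indicator_norm]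
      refine (indicator_le_self' (fun _ _ ↦ norm_nonneg _) x).trans ?_
      rw [RCLike.norm_conj]
      exact norm_waveInt_le ..
    have hBf : volume B < ∞ := measure_closedBall_lt_top
    have hiB : IntegrableOn h B :=
      Measure.integrableOn_of_bounded (M := ∫ ξ, ‖g ξ‖) hBf.ne hm.aestronglyMeasurable
        (.of_forall hb)
    have hi : Integrable h :=
      hiB.integrable_of_forall_notMem_eq_zero fun x hx ↦ indicator_of_notMem hx _
    have hi2 : Integrable fun x ↦ ‖h x‖ ^ 2 := by
      simp only [sq]
      exact hi.norm.mul_bdd hm.norm.aestronglyMeasurable (.of_forall fun x ↦ by simpa using hb x)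
    have hS : ∫⁻ x, ‖h x‖ₑ ^ 2 = ENNReal.ofReal (∫ x, ‖h x‖ ^ 2) := by
      rw [ofReal_integral_eq_lintegral_ofReal hi2 (.of_forall fun x ↦ sq_nonneg _)]
      refine lintegral_congr fun x ↦ ?_
      rw [ENNReal.ofReal_pow (norm_nonneg _), ofReal_norm]
    have hsq : ∫⁻ x in B, ‖waveInt a (τ x) g x‖ₑ ^ 2 = ∫⁻ x, ‖h x‖ₑ ^ 2 := by
      rw [← lintegral_indicator hB]
      refine lintegral_congr fun x ↦ ?_
      by_cases hx : x ∈ B <;> simp [hh, hx]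
    have hfin : ∫⁻ x, ‖h x‖ₑ ^ 2 ≠ ∞ := hS ▸ ENNReal.ofReal_ne_top
    have hpair : ∫⁻ x, ‖h x‖ₑ ^ 2 ≤ ∫⁻ ξ, ‖g ξ‖ₑ * ‖∫ x, h x * wave a (τ x) x ξ‖ₑ := by
      have hprod : Integrable (Function.uncurry fun x ξ ↦ h x * (wave a (τ x) x ξ * g ξ))
          (volume.prod volume) := by
        refine ((hi.mul_prod hg).bdd_mul (c := 1) hwave.aestronglyMeasurable
          (.of_forall fun p ↦ (norm_wave ..).le)).congr (.of_forall fun p ↦ ?_)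
        simp only [Function.uncurry]
        ring
      calc ∫⁻ x, ‖h x‖ₑ ^ 2 = ‖∫ x, ((‖h x‖ ^ 2 : ℝ) : ℂ)‖ₑ := by
            rw [hS, integral_complex_ofReal, ← ofReal_norm, Complex.norm_real,
              Real.norm_of_nonneg (integral_nonneg fun x ↦ sq_nonneg _)]
        _ = ‖∫ x, ∫ ξ, h x * (wave a (τ x) x ξ * g ξ)‖ₑ := by
            congr 2 with x
            rw [integral_const_mul]
            by_cases hx : x ∈ B
            · change _ = h x * waveInt a (τ x) g x
              simp only [hh, indicator_of_mem hx, RCLike.norm_conj, Complex.ofReal_pow]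
              rw [mul_comm, Complex.mul_conj, Complex.normSq_eq_norm_sq, Complex.ofReal_pow]
            · simp [hh, hx]
        _ = ‖∫ ξ, g ξ * ∫ x, h x * wave a (τ x) x ξ‖ₑ := by
            rw [integral_integral_swap hprod]
            congr 2 with ξ
            rw [← integral_const_mul]
            refine integral_congr_ae (.of_forall fun x ↦ ?_)
            simp only
            ring
        _ ≤ _ := by
            refine (enorm_integral_le_lintegral_enorm _).trans_eq ?_
            simp only [enorm_mul]
    have hadj := lintegral_weight_mul_adjoint_le ha hw0 hw hG hGe hτ hK hm hi
    -- The arithmetic-geometric mean inequality with parameter `c` takes the place of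
    -- Cauchy-Schwarz, and half of the left-hand side is absorbed.
    have hmain : c * (∫⁻ x, ‖h x‖ₑ ^ 2) + c * ∫⁻ x, ‖h x‖ₑ ^ 2 ≤
        c * (c * ∫⁻ ξ, ‖g ξ‖ₑ ^ 2) + c * ∫⁻ x, ‖h x‖ₑ ^ 2 := by
      calc c * (∫⁻ x, ‖h x‖ₑ ^ 2) + c * ∫⁻ x, ‖h x‖ₑ ^ 2
          ≤ (2 * c) * ∫⁻ ξ, ‖g ξ‖ₑ * ‖∫ x, h x * wave a (τ x) x ξ‖ₑ := by
            rw [← two_mul, ← mul_assoc]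
            gcongr
        _ = ∫⁻ ξ, 2 * ((c * ‖g ξ‖ₑ) * ‖∫ x, h x * wave a (τ x) x ξ‖ₑ) := by
            rw [← lintegral_const_mul' _ _ (ENNReal.mul_ne_top (by simp) hct)]
            exact lintegral_congr fun ξ ↦ by ring
        _ ≤ ∫⁻ ξ, (c * (c * ‖g ξ‖ₑ ^ 2) +
              ENNReal.ofReal (w ξ) * ‖∫ x, h x * wave a (τ x) x ξ‖ₑ ^ 2) := by
            refine lintegral_mono fun ξ ↦ ?_
            by_cases hξ : g ξ = 0
            · simp [hξ]
            · refine (ENNReal.two_mul_mul_le_sq_add_sq _ _).trans (add_le_add (by ring_nf; rfl) ?_)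
              refine le_mul_of_one_le_left zero_le ?_
              rw [← ENNReal.ofReal_one]
              exact ENNReal.ofReal_le_ofReal (hgw ξ hξ)
        _ = c * (c * ∫⁻ ξ, ‖g ξ‖ₑ ^ 2) +
              ∫⁻ ξ, ENNReal.ofReal (w ξ) * ‖∫ x, h x * wave a (τ x) x ξ‖ₑ ^ 2 := by
            rw [lintegral_add_left' (by fun_prop), lintegral_const_mul' _ _ hct,
              lintegral_const_mul' _ _ hct]
        _ ≤ _ := by
            gcongr
            exact hadj.trans (by gcongr)
    rw [hsq]
    have := (ENNReal.add_le_add_iff_right (ENNReal.mul_ne_top hct hfin)).1 hmain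
    exact (ENNReal.mul_le_mul_iff_right hc0 hct).1 this
  rw [← setLIntegral_univ, ← Metric.iUnion_closedBall_nat (0 : ℝ),
    setLIntegral_iUnion_of_directed]
  · exact iSup_le key
  · exact (monotone_nat_of_le_succ fun n ↦
      Metric.closedBall_subset_closedBall (by simp)).directed_le

/-! ### Van der Corput's second derivative test -/

/-- Integration by parts against `e^{iφ}`; the boundary terms vanish with `v`. -/
theorem integral_exp_mul_deriv_eq {α β : ℝ} (hαβ : α ≤ β) {φ φ' v v' : ℝ → ℝ}
    (hφ : ∀ x ∈ Icc α β, HasDerivAt φ (φ' x) x) (hφ' : ContinuousOn φ' (Icc α β))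
    (hv : ∀ x ∈ Icc α β, HasDerivAt v (v' x) x) (hv' : ContinuousOn v' (Icc α β))
    (hvα : v α = 0) (hvβ : v β = 0) :
    ∫ x in α..β, Complex.exp (Complex.I * (φ x : ℂ)) * ((φ' x * v x : ℝ) : ℂ) =
      Complex.I * ∫ x in α..β, Complex.exp (Complex.I * (φ x : ℂ)) * (v' x : ℂ) := by
  have hI : uIcc α β = Icc α β := uIcc_of_le hαβ
  have hφc : ContinuousOn φ (Icc α β) := fun x hx ↦ (hφ x hx).continuousAt.continuousWithinAt
  have hexp : ContinuousOn (fun x ↦ Complex.exp (Complex.I * (φ x : ℂ))) (Icc α β) := by fun_prop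
  have hd : ∀ x ∈ uIcc α β, HasDerivAt (fun x ↦ Complex.exp (Complex.I * (φ x : ℂ)))
      (Complex.exp (Complex.I * (φ x : ℂ)) * (Complex.I * (φ' x : ℂ))) x := fun x hx ↦
    ((hφ x (hI ▸ hx)).ofReal_comp.const_mul Complex.I).cexp
  have h := intervalIntegral.integral_deriv_mul_eq_sub hd
    (fun x hx ↦ (hv x (hI ▸ hx)).ofReal_comp)
    (ContinuousOn.intervalIntegrable (by rw [hI]; fun_prop))
    (ContinuousOn.intervalIntegrable (by rw [hI]; fun_prop))
  have hvc : ContinuousOn v (Icc α β) := fun x hx ↦ (hv x hx).continuousAt.continuousWithinAt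
  rw [intervalIntegral.integral_add (ContinuousOn.intervalIntegrable (by rw [hI]; fun_prop))
    (ContinuousOn.intervalIntegrable (by rw [hI]; fun_prop)), hvα, hvβ] at h
  have h2 : ∫ x in α..β, Complex.exp (Complex.I * (φ x : ℂ)) * (Complex.I * (φ' x : ℂ)) * (v x : ℂ)
      = Complex.I * ∫ x in α..β, Complex.exp (Complex.I * (φ x : ℂ)) * ((φ' x * v x : ℝ) : ℂ) := by
    rw [← intervalIntegral.integral_const_mul]
    congr 1 with x
    push_cast; ring
  rw [h2] at h
  simp only [Complex.ofReal_zero, mul_zero, sub_zero] at h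
  linear_combination (-Complex.I) * h + (∫ x in α..β, Complex.exp (Complex.I * (φ x : ℂ)) *
    ((φ' x * v x : ℝ) : ℂ)) * Complex.I_sq

theorem norm_exp_I_mul_ofReal (r : ℝ) : ‖Complex.exp (Complex.I * (r : ℂ))‖ = 1 := by
  rw [mul_comm, Complex.norm_exp_ofReal_mul_I]

/-- **Van der Corput's second derivative test** for an amplitude that vanishes at the end points.

Instead of cutting the interval where `φ'` is small, the integrand is split smoothly by
`1 = φ'² / (φ'² + μ) + μ / (φ'² + μ)`. In the first part the factor `φ'` allows an integration by
parts; what is left, and the second part as well, is controlled by `φ'' / (φ'² + μ)`, the derivative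
of `arctan (φ' / √μ) / √μ`, whose integral is at most `π / √μ`. -/
theorem norm_integral_exp_mul_le_of_le_deriv2 {α β μ B : ℝ} (hαβ : α ≤ β) (hμ : 0 < μ)
    {φ φ' φ'' ψ ψ' : ℝ → ℝ}
    (hφ : ∀ x ∈ Icc α β, HasDerivAt φ (φ' x) x) (hφ' : ∀ x ∈ Icc α β, HasDerivAt φ' (φ'' x) x)
    (hφ'' : ContinuousOn φ'' (Icc α β)) (hle : ∀ x ∈ Icc α β, μ ≤ φ'' x)
    (hψ : ∀ x ∈ Icc α β, HasDerivAt ψ (ψ' x) x) (hψ' : ContinuousOn ψ' (Icc α β))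
    (hψα : ψ α = 0) (hψβ : ψ β = 0) (hB : ∀ x ∈ Icc α β, |ψ x| ≤ B)
    (hB' : ∀ x ∈ Icc α β, |ψ' x| ≤ B) :
    ‖∫ x in α..β, Complex.exp (Complex.I * (φ x : ℂ)) * (ψ x : ℂ)‖ ≤
      B * (2 * Real.pi + (β - α)) / √μ := by
  have hI : uIcc α β = Icc α β := uIcc_of_le hαβ
  have hB0 : 0 ≤ B := (abs_nonneg _).trans (hB α ⟨le_rfl, hαβ⟩)
  have hφc : ContinuousOn φ (Icc α β) := fun x hx ↦ (hφ x hx).continuousAt.continuousWithinAt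
  have hφ'c : ContinuousOn φ' (Icc α β) := fun x hx ↦ (hφ' x hx).continuousAt.continuousWithinAt
  have hψc : ContinuousOn ψ (Icc α β) := fun x hx ↦ (hψ x hx).continuousAt.continuousWithinAt
  have hD : ∀ x, 0 < φ' x ^ 2 + μ := fun x ↦ by positivity
  have hD0 : ∀ x, φ' x ^ 2 + μ ≠ 0 := fun x ↦ (hD x).ne'
  set δ := √μ with hδ
  have hδ0 : 0 < δ := Real.sqrt_pos.2 hμ
  have hδ2 : δ ^ 2 = μ := Real.sq_sqrt hμ.le
  set v : ℝ → ℝ := fun x ↦ ψ x * φ' x / (φ' x ^ 2 + μ)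
  set v' : ℝ → ℝ := fun x ↦
    ψ' x * φ' x / (φ' x ^ 2 + μ) + ψ x * φ'' x * (μ - φ' x ^ 2) / (φ' x ^ 2 + μ) ^ 2
  have hv : ∀ x ∈ Icc α β, HasDerivAt v (v' x) x := fun x hx ↦ by
    refine (((hψ x hx).mul (hφ' x hx)).div (((hφ' x hx).pow 2).add_const μ) (hD0 x)).congr_deriv ?_
    simp only [v', Pi.mul_apply, Pi.pow_apply]
    field_simp [hD0 x]
    push_cast
    ring
  have hv'c : ContinuousOn v' (Icc α β) := by
    refine ContinuousOn.add (ContinuousOn.div (by fun_prop) (by fun_prop) fun x _ ↦ hD0 x)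
      (ContinuousOn.div (by fun_prop) (by fun_prop) fun x _ ↦ pow_ne_zero 2 (hD0 x))
  have hparts := integral_exp_mul_deriv_eq hαβ hφ hφ'c hv hv'c (by simp [v, hψα]) (by simp [v, hψβ])
  have hvc : ContinuousOn v (Icc α β) := fun x hx ↦ (hv x hx).continuousAt.continuousWithinAt
  have hrc : ContinuousOn (fun x ↦ ψ x * μ / (φ' x ^ 2 + μ)) (Icc α β) :=
    ContinuousOn.div (by fun_prop) (by fun_prop) fun x _ ↦ hD0 x
  have hsplit : ∫ x in α..β, Complex.exp (Complex.I * (φ x : ℂ)) * (ψ x : ℂ) =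
      ∫ x in α..β, (Complex.I * (Complex.exp (Complex.I * (φ x : ℂ)) * (v' x : ℂ)) +
        Complex.exp (Complex.I * (φ x : ℂ)) * ((ψ x * μ / (φ' x ^ 2 + μ) : ℝ) : ℂ)) := by
    rw [intervalIntegral.integral_add (ContinuousOn.intervalIntegrable (by rw [hI]; fun_prop))
      (ContinuousOn.intervalIntegrable (by rw [hI]; fun_prop)),
      intervalIntegral.integral_const_mul, ← hparts,
      ← intervalIntegral.integral_add (ContinuousOn.intervalIntegrable (by rw [hI]; fun_prop))
      (ContinuousOn.intervalIntegrable (by rw [hI]; fun_prop))]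
    congr 1 with x
    rw [← mul_add, ← Complex.ofReal_add]
    congr 2
    simp only [v]
    field_simp [hD0 x]
  set A : ℝ → ℝ := fun x ↦ Real.arctan (φ' x / δ)
  have hA : ∀ x ∈ uIcc α β, HasDerivAt A (δ * φ'' x / (φ' x ^ 2 + μ)) x := fun x hx ↦ by
    refine ((hφ' x (hI ▸ hx)).div_const δ).arctan.congr_deriv ?_
    rw [← hδ2]
    have := hδ2 ▸ hD0 x
    field_simp
    ring
  have hAc : ContinuousOn (fun x ↦ δ * φ'' x / (φ' x ^ 2 + μ)) (Icc α β) :=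
    ContinuousOn.div (by fun_prop) (by fun_prop) fun x _ ↦ hD0 x
  have hAi : IntervalIntegrable (fun x ↦ δ * φ'' x / (φ' x ^ 2 + μ)) volume α β :=
    ContinuousOn.intervalIntegrable (by rwa [hI])
  have hAint : ∫ x in α..β, δ * φ'' x / (φ' x ^ 2 + μ) ≤ Real.pi := by
    rw [intervalIntegral.integral_eq_sub_of_hasDerivAt hA hAi]
    have h1 := Real.arctan_lt_pi_div_two (φ' β / δ)
    have h2 := Real.neg_pi_div_two_lt_arctan (φ' α / δ)
    simp only [A]; linarith
  have hbound : ∀ x ∈ Icc α β,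
      ‖Complex.I * (Complex.exp (Complex.I * (φ x : ℂ)) * (v' x : ℂ)) +
        Complex.exp (Complex.I * (φ x : ℂ)) * ((ψ x * μ / (φ' x ^ 2 + μ) : ℝ) : ℂ)‖ ≤
      B / δ + 2 * B / δ * (δ * φ'' x / (φ' x ^ 2 + μ)) := fun x hx ↦ by
    have hn : ‖Complex.I * (Complex.exp (Complex.I * (φ x : ℂ)) * (v' x : ℂ)) +
        Complex.exp (Complex.I * (φ x : ℂ)) * ((ψ x * μ / (φ' x ^ 2 + μ) : ℝ) : ℂ)‖ ≤
        |v' x| + |ψ x * μ / (φ' x ^ 2 + μ)| := by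
      refine (norm_add_le _ _).trans_eq ?_
      rw [norm_mul, norm_mul, norm_mul, norm_exp_I_mul_ofReal, Complex.norm_I, Complex.norm_real,
        Complex.norm_real, Real.norm_eq_abs, Real.norm_eq_abs, one_mul, one_mul, one_mul]
    have hφ''0 : 0 ≤ φ'' x := hμ.le.trans (hle x hx)
    have e1 : |ψ' x * φ' x / (φ' x ^ 2 + μ)| ≤ B / δ := by
      rw [abs_div, abs_mul, abs_of_pos (hD x), div_le_div_iff₀ (hD x) hδ0]
      have : |φ' x| * δ ≤ φ' x ^ 2 + μ := by
        rw [← hδ2, ← sq_abs (φ' x)]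
        nlinarith [sq_nonneg (|φ' x| - δ), sq_nonneg (|φ' x|), sq_nonneg δ]
      calc |ψ' x| * |φ' x| * δ = |ψ' x| * (|φ' x| * δ) := by ring
        _ ≤ B * (φ' x ^ 2 + μ) := mul_le_mul (hB' x hx) this (by positivity) hB0
    have e2 : |ψ x * φ'' x * (μ - φ' x ^ 2) / (φ' x ^ 2 + μ) ^ 2| ≤
        B * (φ'' x / (φ' x ^ 2 + μ)) := by
      rw [abs_div, abs_mul, abs_mul, abs_of_pos (pow_pos (hD x) 2), abs_of_nonneg hφ''0,
        div_le_iff₀ (pow_pos (hD x) 2)]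
      have h3 : |μ - φ' x ^ 2| ≤ φ' x ^ 2 + μ := by
        rw [abs_le]; constructor <;> nlinarith [sq_nonneg (φ' x)]
      calc |ψ x| * φ'' x * |μ - φ' x ^ 2| ≤ B * φ'' x * (φ' x ^ 2 + μ) := by
            gcongr; exact hB x hx
        _ = _ := by field_simp [hD0 x]
    have e3 : |ψ x * μ / (φ' x ^ 2 + μ)| ≤ B * (φ'' x / (φ' x ^ 2 + μ)) := by
      rw [abs_div, abs_mul, abs_of_pos (hD x), abs_of_pos hμ, mul_div_assoc]
      have := hD x
      gcongr
      · exact hB x hx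
      · exact hle x hx
    calc _ ≤ |v' x| + |ψ x * μ / (φ' x ^ 2 + μ)| := hn
      _ ≤ (B / δ + B * (φ'' x / (φ' x ^ 2 + μ))) + B * (φ'' x / (φ' x ^ 2 + μ)) :=
          add_le_add ((abs_add_le _ _).trans (add_le_add e1 e2)) e3
      _ = _ := by field_simp; ring
  rw [hsplit]
  refine (intervalIntegral.norm_integral_le_of_norm_le hαβ (.of_forall fun x hx ↦
    hbound x (Ioc_subset_Icc_self hx)) (intervalIntegrable_const.add (hAi.const_mul _))).trans ?_
  rw [intervalIntegral.integral_add intervalIntegrable_const (hAi.const_mul _),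
    intervalIntegral.integral_const, intervalIntegral.integral_const_mul, smul_eq_mul]
  calc (β - α) * (B / δ) + 2 * B / δ * ∫ x in α..β, δ * φ'' x / (φ' x ^ 2 + μ)
      ≤ (β - α) * (B / δ) + 2 * B / δ * Real.pi := by gcongr
    _ = _ := by ring

/-- Van der Corput's test for `φ''` bounded away from zero with either sign `ε`; the negative sign
is reduced to the positive one by complex conjugation. -/
theorem norm_integral_exp_mul_le_of_le_abs_deriv2 {α β μ B ε : ℝ} (hαβ : α ≤ β) (hμ : 0 < μ)
    (hε : ε = 1 ∨ ε = -1) {φ φ' φ'' ψ ψ' : ℝ → ℝ}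
    (hφ : ∀ x ∈ Icc α β, HasDerivAt φ (φ' x) x) (hφ' : ∀ x ∈ Icc α β, HasDerivAt φ' (φ'' x) x)
    (hφ'' : ContinuousOn φ'' (Icc α β)) (hle : ∀ x ∈ Icc α β, μ ≤ ε * φ'' x)
    (hψ : ∀ x ∈ Icc α β, HasDerivAt ψ (ψ' x) x) (hψ' : ContinuousOn ψ' (Icc α β))
    (hψα : ψ α = 0) (hψβ : ψ β = 0) (hB : ∀ x ∈ Icc α β, |ψ x| ≤ B)
    (hB' : ∀ x ∈ Icc α β, |ψ' x| ≤ B) :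
    ‖∫ x in α..β, Complex.exp (Complex.I * (φ x : ℂ)) * (ψ x : ℂ)‖ ≤
      B * (2 * Real.pi + (β - α)) / √μ := by
  have h := norm_integral_exp_mul_le_of_le_deriv2 hαβ hμ (φ := fun x ↦ ε * φ x)
    (fun x hx ↦ (hφ x hx).const_mul ε) (fun x hx ↦ (hφ' x hx).const_mul ε)
    (hφ''.const_mul ε) hle hψ hψ' hψα hψβ hB hB'
  rcases hε with rfl | rfl
  · simpa using h
  · have hconj : ∫ x in α..β, Complex.exp (Complex.I * ((-1 * φ x : ℝ) : ℂ)) * (ψ x : ℂ) =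
        (starRingEnd ℂ) (∫ x in α..β, Complex.exp (Complex.I * (φ x : ℂ)) * (ψ x : ℂ)) := by
      rw [intervalIntegral.integral_of_le hαβ, intervalIntegral.integral_of_le hαβ]
      refine Eq.trans (integral_congr_ae (.of_forall fun x ↦ ?_)) integral_conj
      simp only [map_mul, Complex.conj_ofReal, ← Complex.exp_conj, Complex.conj_I]
      push_cast
      ring_nf
    rwa [hconj, Complex.norm_conj] at h

/-! ### The kernel at unit frequency -/

/-- The polynomial `((4ξ - 1)(2 - ξ))²`, used on `[1/4, 2]` as a bump: it vanishes to second order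
at both end points, so that two integrations by parts leave no boundary terms, and it is at least
`1` on `[1/2, 1]`. -/
def bump (ξ : ℝ) : ℝ := ((4 * ξ - 1) * (2 - ξ)) ^ 2

/-- The derivative of `bump`. -/
def bumpDeriv (ξ : ℝ) : ℝ := 2 * ((4 * ξ - 1) * (2 - ξ)) * (9 - 8 * ξ)

theorem hasDerivAt_bump (ξ : ℝ) : HasDerivAt bump (bumpDeriv ξ) ξ := by
  have h1 : HasDerivAt (fun x : ℝ ↦ (4 * x - 1) * (2 - x)) (9 - 8 * ξ) ξ := by
    refine ((((hasDerivAt_id' ξ).const_mul 4).sub_const 1).mul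
      ((hasDerivAt_id' ξ).const_sub 2)).congr_deriv ?_
    ring
  refine (h1.fun_pow 2).congr_deriv ?_
  simp [bumpDeriv]

theorem hasDerivAt_bumpDeriv (ξ : ℝ) :
    HasDerivAt bumpDeriv (2 * (9 - 8 * ξ) ^ 2 - 16 * ((4 * ξ - 1) * (2 - ξ))) ξ := by
  have h1 : HasDerivAt (fun x : ℝ ↦ 2 * ((4 * x - 1) * (2 - x))) (2 * (9 - 8 * ξ)) ξ := by
    refine (((((hasDerivAt_id' ξ).const_mul 4).sub_const 1).mul
      ((hasDerivAt_id' ξ).const_sub 2)).const_mul 2).congr_deriv ?_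
    ring
  refine (h1.mul (((hasDerivAt_id' ξ).const_mul 8).const_sub 9)).congr_deriv ?_
  ring

theorem continuous_bump : Continuous bump := by unfold bump; fun_prop

theorem continuous_bumpDeriv : Continuous bumpDeriv := by unfold bumpDeriv; fun_prop

theorem bump_nonneg (ξ : ℝ) : 0 ≤ bump ξ := sq_nonneg _

theorem one_le_bump {ξ : ℝ} (h1 : 1 / 2 ≤ ξ) (h2 : ξ ≤ 1) : 1 ≤ bump ξ := by
  have : 1 ≤ (4 * ξ - 1) * (2 - ξ) := by nlinarith
  exact one_le_pow₀ this

theorem abs_bump_le {ξ : ℝ} (h : ξ ∈ Icc (1 / 4) 2) : |bump ξ| ≤ 50 := by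
  obtain ⟨h1, h2⟩ := h
  have h3 : 0 ≤ (4 * ξ - 1) * (2 - ξ) := mul_nonneg (by linarith) (by linarith)
  have h4 : (4 * ξ - 1) * (2 - ξ) ≤ 49 / 16 := by nlinarith [sq_nonneg (ξ - 9 / 8)]
  rw [abs_of_nonneg (bump_nonneg ξ), bump]
  nlinarith

theorem abs_bumpDeriv_le {ξ : ℝ} (h : ξ ∈ Icc (1 / 4) 2) : |bumpDeriv ξ| ≤ 50 := by
  obtain ⟨h1, h2⟩ := h
  have h3 : 0 ≤ (4 * ξ - 1) * (2 - ξ) := mul_nonneg (by linarith) (by linarith)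
  have h4 : (4 * ξ - 1) * (2 - ξ) ≤ 49 / 16 := by nlinarith [sq_nonneg (ξ - 9 / 8)]
  have h5 : |9 - 8 * ξ| ≤ 7 := abs_le.2 ⟨by linarith, by linarith⟩
  rw [bumpDeriv, abs_mul, abs_of_nonneg (by positivity)]
  calc _ ≤ 2 * (49 / 16 : ℝ) * 7 := by gcongr
    _ ≤ 50 := by norm_num

theorem exists_rpow_bounds (b : ℝ) :
    ∃ m > 0, ∃ M > 0, ∀ ξ ∈ Icc (1 / 4 : ℝ) 2, m ≤ ξ ^ b ∧ ξ ^ b ≤ M := by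
  have hc : ContinuousOn (fun ξ : ℝ ↦ ξ ^ b) (Icc (1 / 4) 2) := fun ξ hξ ↦
    (Real.continuousAt_rpow_const ξ b (Or.inl (by linarith [hξ.1]))).continuousWithinAt
  have hne : (Icc (1 / 4 : ℝ) 2).Nonempty := ⟨1, by norm_num, by norm_num⟩
  obtain ⟨x, hx, hxm⟩ := isCompact_Icc.exists_isMinOn hne hc
  obtain ⟨z, hz, hzm⟩ := isCompact_Icc.exists_isMaxOn hne hc
  exact ⟨x ^ b, Real.rpow_pos_of_pos (by linarith [hx.1]) b, z ^ b,
    Real.rpow_pos_of_pos (by linarith [hz.1]) b, fun ξ hξ ↦ ⟨hxm hξ, hzm hξ⟩⟩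

/-- The oscillatory integral `∫ e^{i (ξ y + s ξ^a)} bump(ξ) dξ` over `[1/4, 2]`: the contribution of
the positive frequencies to the kernel at unit scale. -/
noncomputable def bumpInt (a y s : ℝ) : ℂ :=
  ∫ ξ in (1 / 4 : ℝ)..2, Complex.exp (Complex.I * ((ξ * y + s * ξ ^ a : ℝ) : ℂ)) * (bump ξ : ℂ)

theorem norm_bumpInt_le (a y s : ℝ) : ‖bumpInt a y s‖ ≤ 100 := by
  refine (intervalIntegral.norm_integral_le_of_norm_le_const (C := 50) fun ξ hξ ↦ ?_).trans ?_
  · rw [uIoc_of_le (by norm_num)] at hξ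
    rw [norm_mul, norm_exp_I_mul_ofReal, one_mul, Complex.norm_real]
    exact abs_bump_le (Ioc_subset_Icc_self hξ)
  · norm_num

theorem hasDerivAt_rpow_of_mem {ξ : ℝ} (h : ξ ∈ Icc (1 / 4 : ℝ) 2) (b : ℝ) :
    HasDerivAt (fun x : ℝ ↦ x ^ b) (b * ξ ^ (b - 1)) ξ :=
  Real.hasDerivAt_rpow_const (Or.inl (by linarith [h.1]))

/-- Where `|y|` dominates `|s|` the phase has no stationary point and two integrations by parts
give the decay `y⁻²`. After division by `y` the phase is `ξ + r ξ^a` with `r = s / y` in a compact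
interval, so the amplitude `u₂` produced by the two integrations by parts is bounded by
compactness. -/
theorem exists_norm_bumpInt_le_of_nonstationary {a : ℝ} (ha : 0 < a) :
    ∃ R > 0, ∃ C > 0, ∀ y s : ℝ, y ≠ 0 → R * |s| ≤ |y| → ‖bumpInt a y s‖ ≤ C / y ^ 2 := by
  obtain ⟨_, _, M, hM, hbd⟩ := exists_rpow_bounds (a - 1)
  set K : Set (ℝ × ℝ) := Icc (-(1 / (2 * a * M))) (1 / (2 * a * M)) ×ˢ Icc (1 / 4) 2 with hKdef
  have hK : IsCompact K := isCompact_Icc.prod isCompact_Icc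
  set P : ℝ → ℝ → ℝ := fun r ξ ↦ 1 + r * (a * ξ ^ (a - 1)) with hP
  set P' : ℝ → ℝ → ℝ := fun r ξ ↦ r * (a * ((a - 1) * ξ ^ (a - 1 - 1))) with hP'
  set P'' : ℝ → ℝ → ℝ := fun r ξ ↦ r * (a * ((a - 1) * ((a - 1 - 1) * ξ ^ (a - 1 - 1 - 1))))
    with hP''
  have hPpos : ∀ p ∈ K, 1 / 2 ≤ P p.1 p.2 := fun p hp ↦ by
    have h1 := hbd p.2 hp.2
    have h0 : 0 < p.2 ^ (a - 1) := Real.rpow_pos_of_pos (by linarith [hp.2.1]) _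
    have h2 : |p.1 * (a * p.2 ^ (a - 1))| ≤ 1 / 2 := by
      rw [abs_mul, abs_of_pos (mul_pos ha h0)]
      calc |p.1| * (a * p.2 ^ (a - 1)) ≤ 1 / (2 * a * M) * (a * M) := by
            gcongr
            · exact abs_le.2 hp.1
            · exact h1.2
        _ = 1 / 2 := by field_simp
    have := (abs_le.1 h2).1
    simp only [hP]; linarith
  have hP0 : ∀ p ∈ K, P p.1 p.2 ≠ 0 := fun p hp ↦ by linarith [hPpos p hp]
  set u₂ : ℝ → ℝ → ℝ := fun r ξ ↦
    (2 * (9 - 8 * ξ) ^ 2 - 16 * ((4 * ξ - 1) * (2 - ξ))) / P r ξ ^ 2 -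
      3 * bumpDeriv ξ * P' r ξ / P r ξ ^ 3 - bump ξ * P'' r ξ / P r ξ ^ 3 +
      3 * bump ξ * P' r ξ ^ 2 / P r ξ ^ 4 with hu₂
  have hrpow : ∀ b : ℝ, ContinuousOn (fun p : ℝ × ℝ ↦ p.2 ^ b) K := fun b ↦
    continuousOn_snd.rpow_const fun p hp ↦ Or.inl (by linarith [hp.2.1])
  have hPc : ContinuousOn (fun p : ℝ × ℝ ↦ P p.1 p.2) K := by
    have := hrpow (a - 1); simp only [hP]; fun_prop
  have hP'c : ContinuousOn (fun p : ℝ × ℝ ↦ P' p.1 p.2) K := by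
    have := hrpow (a - 1 - 1); simp only [hP']; fun_prop
  have hP''c : ContinuousOn (fun p : ℝ × ℝ ↦ P'' p.1 p.2) K := by
    have := hrpow (a - 1 - 1 - 1); simp only [hP'']; fun_prop
  have hbc : ContinuousOn (fun p : ℝ × ℝ ↦ bump p.2) K :=
    (continuous_bump.comp continuous_snd).continuousOn
  have hbc' : ContinuousOn (fun p : ℝ × ℝ ↦ bumpDeriv p.2) K :=
    (continuous_bumpDeriv.comp continuous_snd).continuousOn
  have hu₂c : ContinuousOn (fun p : ℝ × ℝ ↦ u₂ p.1 p.2) K := by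
    refine (((ContinuousOn.div ?_ ?_ ?_).sub (ContinuousOn.div ?_ ?_ ?_)).sub
      (ContinuousOn.div ?_ ?_ ?_)).add (ContinuousOn.div ?_ ?_ ?_)
    all_goals first | fun_prop | exact fun p hp ↦ pow_ne_zero _ (hP0 p hp)
  obtain ⟨D, hD⟩ := hK.exists_bound_of_continuousOn hu₂c
  refine ⟨2 * a * M, by positivity, 2 * |D| + 1, by positivity, fun y s hy hs ↦ ?_⟩
  set r := s / y with hr
  have hrK : ∀ ξ ∈ Icc (1 / 4 : ℝ) 2, (r, ξ) ∈ K := fun ξ hξ ↦ by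
    refine ⟨abs_le.1 ?_, hξ⟩
    rw [hr, abs_div, div_le_div_iff₀ (abs_pos.2 hy) (by positivity)]
    linarith
  have hsec : ∀ {F : ℝ × ℝ → ℝ}, ContinuousOn F K →
      ContinuousOn (fun ξ ↦ F (r, ξ)) (Icc (1 / 4) 2) := fun hF ↦
    hF.comp (by fun_prop) hrK
  have hφ : ∀ ξ ∈ Icc (1 / 4 : ℝ) 2,
      HasDerivAt (fun x ↦ x * y + s * x ^ a) (y * P r ξ) ξ := fun ξ hξ ↦ by
    refine (((hasDerivAt_id' ξ).mul_const y).add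
      ((hasDerivAt_rpow_of_mem hξ a).const_mul s)).congr_deriv ?_
    simp only [hP, hr]; field_simp
  have hPd : ∀ ξ ∈ Icc (1 / 4 : ℝ) 2, HasDerivAt (P r) (P' r ξ) ξ := fun ξ hξ ↦
    ((((hasDerivAt_rpow_of_mem hξ (a - 1)).const_mul a).const_mul r).const_add 1)
  have hP'd : ∀ ξ ∈ Icc (1 / 4 : ℝ) 2, HasDerivAt (P' r) (P'' r ξ) ξ := fun ξ hξ ↦
    ((((hasDerivAt_rpow_of_mem hξ (a - 1 - 1)).const_mul (a - 1)).const_mul a).const_mul r)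
  set u₁ : ℝ → ℝ := fun ξ ↦ bumpDeriv ξ / P r ξ - bump ξ * P' r ξ / P r ξ ^ 2 with hu₁
  have hd1 : ∀ ξ ∈ Icc (1 / 4 : ℝ) 2, HasDerivAt (fun x ↦ bump x / P r x) (u₁ ξ) ξ :=
    fun ξ hξ ↦ by
    have h0 := hP0 _ (hrK ξ hξ)
    refine ((hasDerivAt_bump ξ).div (hPd ξ hξ) h0).congr_deriv ?_
    simp only [hu₁]
    field_simp
  have hd2 : ∀ ξ ∈ Icc (1 / 4 : ℝ) 2, HasDerivAt (fun x ↦ u₁ x / P r x) (u₂ r ξ) ξ :=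
    fun ξ hξ ↦ by
    have h0 := hP0 _ (hrK ξ hξ)
    have h1 := ((hasDerivAt_bumpDeriv ξ).div (hPd ξ hξ) h0).sub
      (((hasDerivAt_bump ξ).mul (hP'd ξ hξ)).div ((hPd ξ hξ).pow 2) (pow_ne_zero 2 h0))
    refine (h1.div (hPd ξ hξ) h0).congr_deriv ?_
    simp only [hu₂, Pi.sub_apply, Pi.mul_apply, Pi.div_apply, Pi.pow_apply]
    generalize P r ξ = A at *
    field_simp
    push_cast
    ring
  have hPr : ContinuousOn (fun ξ ↦ P r ξ) (Icc (1 / 4) 2) := hsec hPc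
  have hu₁c : ContinuousOn u₁ (Icc (1 / 4) 2) := by
    have := hsec hP'c
    have := hsec hbc
    have := hsec hbc'
    refine ContinuousOn.sub (ContinuousOn.div (by fun_prop) hPr fun ξ hξ ↦ hP0 _ (hrK ξ hξ))
      (ContinuousOn.div (by fun_prop) (hPr.pow 2) fun ξ hξ ↦ pow_ne_zero 2 (hP0 _ (hrK ξ hξ)))
  have e1 := integral_exp_mul_deriv_eq (by norm_num) hφ (by fun_prop) hd1 hu₁c
    (by simp [bump]) (by simp [bump])
  have e2 := integral_exp_mul_deriv_eq (by norm_num) hφ (by fun_prop) hd2 (hsec hu₂c)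
    (by simp [hu₁, bump, bumpDeriv]) (by simp [hu₁, bump, bumpDeriv])
  have key : ∀ u : ℝ → ℝ, ∫ x in (1 / 4 : ℝ)..2,
      Complex.exp (Complex.I * ((x * y + s * x ^ a : ℝ) : ℂ)) *
        ((y * P r x * (u x / P r x) : ℝ) : ℂ) =
      y * ∫ x in (1 / 4 : ℝ)..2,
      Complex.exp (Complex.I * ((x * y + s * x ^ a : ℝ) : ℂ)) * (u x : ℂ) := fun u ↦ by
    rw [← intervalIntegral.integral_const_mul]
    refine intervalIntegral.integral_congr fun x hx ↦ ?_
    rw [uIcc_of_le (by norm_num)] at hx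
    have h0 := hP0 _ (hrK x hx)
    have : y * P r x * (u x / P r x) = y * u x := by simp only at h0; field_simp
    simp only [this]
    push_cast; ring
  rw [key] at e1 e2
  have hy2 : (y : ℂ) ^ 2 * bumpInt a y s = -∫ x in (1 / 4 : ℝ)..2,
      Complex.exp (Complex.I * ((x * y + s * x ^ a : ℝ) : ℂ)) * (u₂ r x : ℂ) := by
    rw [bumpInt]
    linear_combination (y : ℂ) * e1 + Complex.I * e2 + (∫ x in (1 / 4 : ℝ)..2,
      Complex.exp (Complex.I * ((x * y + s * x ^ a : ℝ) : ℂ)) * (u₂ r x : ℂ)) * Complex.I_sq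
  have hn : y ^ 2 * ‖bumpInt a y s‖ ≤ 2 * |D| + 1 := by
    have : ‖(y : ℂ) ^ 2 * bumpInt a y s‖ = y ^ 2 * ‖bumpInt a y s‖ := by
      rw [norm_mul, norm_pow, Complex.norm_real, Real.norm_eq_abs, sq_abs]
    rw [← this, hy2, norm_neg]
    refine (intervalIntegral.norm_integral_le_of_norm_le_const (C := |D|) fun ξ hξ ↦ ?_).trans ?_
    · rw [uIoc_of_le (by norm_num)] at hξ
      rw [norm_mul, norm_exp_I_mul_ofReal, one_mul, Complex.norm_real]
      exact (hD _ (hrK ξ (Ioc_subset_Icc_self hξ))).trans (le_abs_self D)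
    · have : |(2 : ℝ) - 1 / 4| ≤ 2 := by rw [abs_le]; norm_num
      nlinarith [abs_nonneg D]
  rw [le_div_iff₀ (by positivity)]
  linarith

/-- The two bounds for the kernel at unit scale: `|y|^{-1/2}` uniformly in `s`, and integrable decay
where `|y| ≥ R |s|`. The first comes from van der Corput's test if `|s|` is comparable to `|y|` or
larger, since the second derivative of the phase is then at least a multiple of `|y|`; this is where
`a ≠ 1` enters. -/
theorem exists_norm_bumpInt_le {a : ℝ} (ha : 0 < a) (ha1 : a ≠ 1) :
    ∃ R > 0, ∃ C > 0, ∀ y s : ℝ, (y ≠ 0 → ‖bumpInt a y s‖ ≤ C / √|y|) ∧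
      (R * |s| ≤ |y| → ‖bumpInt a y s‖ ≤ C / (1 + y ^ 2)) := by
  obtain ⟨R, hR, C, hC, hns⟩ := exists_norm_bumpInt_le_of_nonstationary ha
  obtain ⟨m, hm, _, _, hbd⟩ := exists_rpow_bounds (a - 1 - 1)
  have ha1' : 0 < |a - 1| := abs_pos.2 (sub_ne_zero.2 ha1)
  set k := a * |a - 1| * m / R with hk
  have hk0 : 0 < k := by positivity
  set E := 50 * (2 * Real.pi + (2 - 1 / 4)) with hE
  have hE0 : 0 < E := by have := Real.pi_pos; rw [hE]; linarith
  have hfar : ∀ y s : ℝ, R * |s| ≤ |y| → ‖bumpInt a y s‖ ≤ (C + 100) / (1 + y ^ 2) :=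
    fun y s hs ↦ by
    rw [le_div_iff₀ (by positivity)]
    have h1 := norm_bumpInt_le a y s
    rcases eq_or_ne y 0 with rfl | hy
    · simp; linarith
    · have h2 := hns y s hy hs
      rw [le_div_iff₀ (by positivity)] at h2
      linarith
  have hCle : C + 100 ≤ C + 100 + E / √k := by linarith [div_pos hE0 (Real.sqrt_pos.2 hk0)]
  refine ⟨R, hR, C + 100 + E / √k, by positivity, fun y s ↦ ⟨fun hy ↦ ?_, fun hs ↦ ?_⟩⟩
  · have hy0 : 0 < |y| := abs_pos.2 hy
    have hsy : 0 < √|y| := Real.sqrt_pos.2 hy0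
    by_cases hs : R * |s| ≤ |y|
    · refine (hfar y s hs).trans ?_
      have h1 : √|y| ≤ 1 + y ^ 2 := by
        rw [← sq_abs y]
        have h2 := Real.sq_sqrt (abs_nonneg y)
        nlinarith [sq_nonneg (√|y| - 1), sq_nonneg (|y| - 1)]
      exact div_le_div₀ (by positivity) hCle hsy h1
    · push Not at hs
      have hs0 : 0 < |s| := by
        rw [abs_pos]; rintro rfl; simp at hs; linarith
      have hμ : 0 < |s| * (a * |a - 1| * m) := by positivity
      have hsgn : s * (a - 1) ≠ 0 := mul_ne_zero (abs_pos.1 hs0) (sub_ne_zero.2 ha1)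
      obtain ⟨ε, hε, hεs⟩ : ∃ ε : ℝ, (ε = 1 ∨ ε = -1) ∧ ε * (s * (a - 1)) = |s| * |a - 1| := by
        rw [← abs_mul]
        rcases abs_cases (s * (a - 1)) with ⟨h, -⟩ | ⟨h, -⟩
        · exact ⟨1, Or.inl rfl, by rw [h, one_mul]⟩
        · exact ⟨-1, Or.inr rfl, by rw [h]; ring⟩
      have hvdc := norm_integral_exp_mul_le_of_le_abs_deriv2 (α := 1 / 4) (β := 2)
        (by norm_num) hμ hε
        (φ := fun ξ ↦ ξ * y + s * ξ ^ a) (φ' := fun ξ ↦ 1 * y + s * (a * ξ ^ (a - 1)))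
        (φ'' := fun ξ ↦ s * (a * ((a - 1) * ξ ^ (a - 1 - 1))))
        (fun ξ hξ ↦ ((hasDerivAt_id' ξ).mul_const y).add
          ((hasDerivAt_rpow_of_mem hξ a).const_mul s))
        (fun ξ hξ ↦ ((((hasDerivAt_rpow_of_mem hξ (a - 1)).const_mul a).const_mul s).const_add _))
        (by
          have : ContinuousOn (fun ξ : ℝ ↦ ξ ^ (a - 1 - 1)) (Icc (1 / 4) 2) :=
            continuousOn_id.rpow_const fun ξ hξ ↦ Or.inl (by simp only [id]; linarith [hξ.1])
          fun_prop)
        (fun ξ hξ ↦ by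
          calc |s| * (a * |a - 1| * m) = |s| * |a - 1| * a * m := by ring
            _ ≤ |s| * |a - 1| * a * ξ ^ (a - 1 - 1) := by gcongr; exact (hbd ξ hξ).1
            _ = _ := by rw [← hεs]; ring)
        (fun ξ _ ↦ hasDerivAt_bump ξ) continuous_bumpDeriv.continuousOn
        (by simp [bump]) (by simp [bump]) (fun ξ hξ ↦ abs_bump_le hξ)
        (fun ξ hξ ↦ abs_bumpDeriv_le hξ)
      refine hvdc.trans ?_
      have hμk : k * |y| ≤ |s| * (a * |a - 1| * m) := by
        rw [hk, div_mul_eq_mul_div, div_le_iff₀ hR]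
        calc a * |a - 1| * m * |y| ≤ a * |a - 1| * m * (R * |s|) := by gcongr
          _ = _ := by ring
      calc E / √(|s| * (a * |a - 1| * m)) ≤ E / √(k * |y|) := by gcongr
        _ = E / √k / √|y| := by rw [Real.sqrt_mul hk0.le, div_div]
        _ ≤ _ := by gcongr; linarith
  · exact (hfar y s hs).trans (div_le_div_of_nonneg_right hCle (by positivity))

/-! ### Linearised estimates on annuli and balls -/

/-- The bump rescaled to the annulus `lam / 4 ≤ |ξ| ≤ 2 lam`, even in `ξ` and zero outside. -/
noncomputable def annulusWeight (lam ξ : ℝ) : ℝ := (Icc (1 / 4) 2).indicator bump (|ξ| / lam)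

theorem annulusWeight_nonneg (lam ξ : ℝ) : 0 ≤ annulusWeight lam ξ :=
  indicator_nonneg (fun _ _ ↦ bump_nonneg _) _

theorem one_le_annulusWeight {lam ξ : ℝ} (hlam : 0 < lam) (h1 : lam / 2 ≤ |ξ|) (h2 : |ξ| ≤ lam) :
    1 ≤ annulusWeight lam ξ := by
  have h3 : 1 / 2 ≤ |ξ| / lam := by rw [le_div_iff₀ hlam]; linarith
  have h4 : |ξ| / lam ≤ 1 := (div_le_one hlam).2 h2
  have h5 : |ξ| / lam ∈ Icc (1 / 4 : ℝ) 2 := ⟨by linarith, by linarith⟩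
  rw [annulusWeight, indicator_of_mem h5]
  exact one_le_bump h3 h4

theorem integrable_annulusWeight {lam : ℝ} (hlam : 0 < lam) : Integrable (annulusWeight lam) := by
  have h1 : Measurable (annulusWeight lam) :=
    (continuous_bump.measurable.indicator measurableSet_Icc).comp (by fun_prop)
  have h2 : IntegrableOn (annulusWeight lam) (Metric.closedBall 0 (2 * lam)) := by
    refine Measure.integrableOn_of_bounded (M := 50) measure_closedBall_lt_top.ne
      h1.aestronglyMeasurable (.of_forall fun ξ ↦ ?_)
    rw [annulusWeight, norm_indicator_eq_indicator_norm]
    exact indicator_le' (fun x hx ↦ abs_bump_le hx) (fun _ _ ↦ by norm_num) _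
  refine h2.integrable_of_forall_notMem_eq_zero fun ξ hξ ↦ indicator_of_notMem (fun h ↦ hξ ?_) _
  have := (div_le_iff₀ hlam).1 h.2
  simpa using this

theorem waveInt_annulusWeight_one {a : ℝ} (ha : 0 < a) (y s : ℝ) :
    waveInt a s (fun ξ ↦ (annulusWeight 1 ξ : ℂ)) y = bumpInt a y s + bumpInt a (-y) s := by
  have hw : Integrable fun ξ ↦ (annulusWeight 1 ξ : ℂ) := (integrable_annulusWeight one_pos).ofReal
  have hint := integrable_wave_mul ha hw s y
  have half : ∀ y, ∫ ξ in Ioi (0 : ℝ), wave a s y ξ * (annulusWeight 1 ξ : ℂ) = bumpInt a y s := by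
    intro y
    rw [bumpInt, intervalIntegral.integral_of_le (by norm_num), ← integral_Icc_eq_integral_Ioc]
    have hsub : Ioi (0 : ℝ) ∩ Icc (1 / 4) 2 = Icc (1 / 4) 2 :=
      inter_eq_right.2 fun x hx ↦ lt_of_lt_of_le (by norm_num) hx.1
    rw [← hsub, ← setIntegral_indicator measurableSet_Icc]
    refine setIntegral_congr_fun measurableSet_Ioi fun ξ hξ ↦ ?_
    rw [mem_Ioi] at hξ
    by_cases h : ξ ∈ Icc (1 / 4 : ℝ) 2
    · simp only [annulusWeight, abs_of_pos hξ, div_one, indicator_of_mem h, wave_eq_exp]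
    · simp only [annulusWeight, abs_of_pos hξ, div_one, indicator_of_notMem h, Complex.ofReal_zero,
        mul_zero]
  rw [waveInt, ← integral_add_compl measurableSet_Ioi hint, compl_Ioi, half, ← half (-y)]
  congr 1
  have := integral_comp_neg_Ioi (0 : ℝ) fun ξ ↦ wave a s y ξ * (annulusWeight 1 ξ : ℂ)
  rw [neg_zero] at this
  rw [← this]
  simp only [annulusWeight, wave_eq_exp, abs_neg, neg_mul, mul_neg]

/-- Scaling reduces the kernel of the annulus at frequency `lam` to the one at frequency `1`. -/
theorem waveInt_annulusWeight {lam : ℝ} (hlam : 0 < lam) (a t x : ℝ) :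
    waveInt a t (fun ξ ↦ (annulusWeight lam ξ : ℂ)) x =
      lam * waveInt a (t * lam ^ a) (fun ξ ↦ (annulusWeight 1 ξ : ℂ)) (lam * x) := by
  have h := Measure.integral_comp_mul_left
    (fun ξ ↦ wave a t x ξ * (annulusWeight lam ξ : ℂ)) lam
  rw [abs_of_pos (inv_pos.2 hlam)] at h
  have h2 : ∫ ξ, wave a t x (lam * ξ) * (annulusWeight lam (lam * ξ) : ℂ) =
      waveInt a (t * lam ^ a) (fun ξ ↦ (annulusWeight 1 ξ : ℂ)) (lam * x) := by
    refine integral_congr_ae (.of_forall fun ξ ↦ ?_)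
    simp only [wave_eq_exp, annulusWeight, abs_mul, abs_of_pos hlam, div_one,
      Real.mul_rpow hlam.le (abs_nonneg ξ), mul_div_cancel_left₀ _ hlam.ne']
    ring_nf
  rw [← h2, h, Complex.real_smul]
  push_cast
  rw [← mul_assoc, mul_inv_cancel₀ (by exact_mod_cast hlam.ne'), one_mul]
  rfl

/-- The majorant `C (1 + y²)⁻¹ + C |y|^{-1/2} 1_{|y| ≤ A}` of the kernel at unit scale. At `y = 0`
the second term is `0`, because `0` raised to a negative real power is `0`; the first term bounds
the kernel there. -/
noncomputable def kernelProfile (C A y : ℝ) : ℝ :=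
  C * (1 + y ^ 2)⁻¹ + C * (Iic A).indicator (fun r ↦ r ^ (-(1 / 2) : ℝ)) |y|

theorem kernelProfile_neg (C A y : ℝ) : kernelProfile C A (-y) = kernelProfile C A y := by
  simp [kernelProfile]

theorem measurable_kernelProfile (C A : ℝ) : Measurable (kernelProfile C A) := by
  have : Measurable ((Iic A).indicator fun r : ℝ ↦ r ^ (-(1 / 2) : ℝ)) :=
    (measurable_id.pow_const _).indicator measurableSet_Iic
  unfold kernelProfile
  fun_prop

theorem kernelProfile_nonneg {C : ℝ} (hC : 0 ≤ C) (A y : ℝ) : 0 ≤ kernelProfile C A y := by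
  have : 0 ≤ (Iic A).indicator (fun r ↦ r ^ (-(1 / 2) : ℝ)) |y| :=
    indicator_apply_nonneg fun _ ↦ Real.rpow_nonneg (abs_nonneg y) _
  unfold kernelProfile
  positivity

/-- The integral of the majorant grows only like `√A`, which is the source of the exponent `1/4`
of the maximal estimate. -/
theorem integral_kernelProfile {A : ℝ} (C : ℝ) (hA : 0 < A) :
    Integrable (kernelProfile C A) ∧ ∫ y, kernelProfile C A y = C * (Real.pi + 4 * √A) := by
  have h3 : ∫ y, (Iic A).indicator (fun r : ℝ ↦ r ^ (-(1 / 2) : ℝ)) |y| = 4 * √A := by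
    rw [integral_comp_abs, setIntegral_indicator measurableSet_Iic, Ioi_inter_Iic,
      ← intervalIntegral.integral_of_le hA.le, integral_rpow (Or.inl (by norm_num)),
      Real.sqrt_eq_rpow]
    norm_num
    ring
  -- A function that is not integrable has integral `0`, whereas `4 * √A > 0`.
  have h2 : Integrable fun y ↦ (Iic A).indicator (fun r : ℝ ↦ r ^ (-(1 / 2) : ℝ)) |y| :=
    .of_integral_ne_zero (h3 ▸ by positivity)
  refine ⟨(integrable_inv_one_add_sq.const_mul C).add (h2.const_mul C), ?_⟩
  unfold kernelProfile
  rw [integral_add (integrable_inv_one_add_sq.const_mul C) (h2.const_mul C), integral_const_mul,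
    integral_const_mul, h3, integral_univ_inv_one_add_sq]
  ring

/-- The kernel of the annulus is dominated, uniformly over times `|t| ≤ L`, by the rescaled majorant
whose cutoff is a multiple of `L * lam ^ a`. -/
theorem exists_norm_waveInt_annulusWeight_le {a : ℝ} (ha : 0 < a) (ha1 : a ≠ 1) :
    ∃ R > 0, ∃ C > 0, ∀ lam > 0, ∀ L t x : ℝ, |t| ≤ L →
      ‖waveInt a t (fun ξ ↦ (annulusWeight lam ξ : ℂ)) x‖ ≤
        lam * kernelProfile C (R * (L * lam ^ a)) (lam * x) := by
  obtain ⟨R, hR, C, hC, h⟩ := exists_norm_bumpInt_le ha ha1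
  refine ⟨R, hR, 2 * (C + 100), by positivity, fun lam hlam L t x ht ↦ ?_⟩
  have hp : 0 < lam ^ a := Real.rpow_pos_of_pos hlam a
  have key : ∀ y s, |s| ≤ L * lam ^ a →
      ‖bumpInt a y s‖ ≤ kernelProfile (C + 100) (R * (L * lam ^ a)) y := fun y s hs ↦ by
    have h0 := norm_bumpInt_le a y s
    have hinv : 0 < (1 + y ^ 2)⁻¹ := by positivity
    by_cases hy : |y| ≤ R * (L * lam ^ a)
    · rw [kernelProfile, indicator_of_mem (mem_Iic.2 hy)]
      rcases eq_or_ne y 0 with rfl | hy0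
      · rw [abs_zero, Real.zero_rpow (by norm_num)]
        simp; linarith
      · have h1 := (h y s).1 hy0
        rw [Real.sqrt_eq_rpow, div_eq_mul_inv, ← Real.rpow_neg (abs_nonneg y)] at h1
        have h2 : 0 < |y| ^ (-(1 / 2) : ℝ) := Real.rpow_pos_of_pos (abs_pos.2 hy0) _
        nlinarith [mul_pos hC hinv]
    · rw [kernelProfile, indicator_of_notMem (by simpa using hy)]
      push Not at hy
      have h1 := (h y s).2 ((mul_le_mul_of_nonneg_left hs hR.le).trans hy.le)
      rw [div_eq_mul_inv] at h1
      linarith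
  rw [waveInt_annulusWeight hlam, waveInt_annulusWeight_one ha, norm_mul, Complex.norm_real,
    Real.norm_of_nonneg hlam.le]
  have hs : |t * lam ^ a| ≤ L * lam ^ a := by
    rw [abs_mul, abs_of_pos hp]; gcongr
  have e1 := key (lam * x) _ hs
  have e2 := key (-(lam * x)) _ hs
  rw [kernelProfile_neg] at e2
  gcongr
  refine (norm_add_le _ _).trans ((add_le_add e1 e2).trans_eq ?_)
  unfold kernelProfile; ring

/-- The linearised maximal estimate for frequencies in a dyadic annulus, when the time interval is
at least as long as the period `lam ^ (-a)` of the waves. -/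
theorem exists_lintegral_waveInt_sq_le_annulus {a : ℝ} (ha : 0 < a) (ha1 : a ≠ 1) :
    ∃ C > 0, ∀ lam > 0, ∀ L ≥ 0, 1 ≤ L * lam ^ a → ∀ τ : ℝ → ℝ, Measurable τ →
      (∀ x y, |τ x - τ y| ≤ L) → ∀ g : ℝ → ℂ, Integrable g →
      (∀ ξ, g ξ ≠ 0 → lam / 2 ≤ |ξ| ∧ |ξ| ≤ lam) →
      ∫⁻ x, ‖waveInt a (τ x) g x‖ₑ ^ 2 ≤
        ENNReal.ofReal (C * √(L * lam ^ a)) * ∫⁻ ξ, ‖g ξ‖ₑ ^ 2 := by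
  obtain ⟨R, hR, C, hC, h⟩ := exists_norm_waveInt_annulusWeight_le ha ha1
  refine ⟨C * (Real.pi + 4 * √R), by positivity, fun lam hlam L hL hM τ hτ hτL g hg hsupp ↦ ?_⟩
  have hM0 : 0 < L * lam ^ a := by linarith
  obtain ⟨hi, he⟩ := integral_kernelProfile C (A := R * (L * lam ^ a)) (by positivity)
  have hmeas := measurable_kernelProfile C (R * (L * lam ^ a))
  refine lintegral_waveInt_sq_le ha (annulusWeight_nonneg lam) (integrable_annulusWeight hlam)
    (G := fun x ↦ ENNReal.ofReal (lam * kernelProfile C (R * (L * lam ^ a)) (lam * x)))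
    (by fun_prop) (fun x ↦ by rw [mul_neg, kernelProfile_neg]) hτ (fun x y ↦ ?_) ?_ ?_
    ENNReal.ofReal_ne_top hg (fun ξ hξ ↦ one_le_annulusWeight hlam (hsupp ξ hξ).1 (hsupp ξ hξ).2)
  · rw [← ofReal_norm]
    exact ENNReal.ofReal_le_ofReal (h lam hlam L _ _ (hτL x y))
  · rw [← ofReal_integral_eq_lintegral_ofReal ((hi.comp_mul_left' hlam.ne').const_mul lam)
      (.of_forall fun x ↦ mul_nonneg hlam.le (kernelProfile_nonneg hC.le _ _)), integral_const_mul,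
      Measure.integral_comp_mul_left, abs_of_pos (inv_pos.2 hlam), smul_eq_mul, ← mul_assoc,
      mul_inv_cancel₀ hlam.ne', one_mul, he, Real.sqrt_mul hR.le]
    refine ENNReal.ofReal_le_ofReal ?_
    have h1 : 1 ≤ √(L * lam ^ a) := Real.one_le_sqrt.2 hM
    have : C * Real.pi * 1 ≤ C * Real.pi * √(L * lam ^ a) := by gcongr
    nlinarith
  · have : 0 < √(L * lam ^ a) := Real.sqrt_pos.2 hM0
    exact (ENNReal.ofReal_pos.2 (by positivity)).ne'

/-- Plancherel's inequality at a fixed time, with a constant `2πe` in place of `2π`. It is the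
`T T*` bound for constant `τ` and the Gaussian weight `e^{1 - ξ² / lam²}`, whose kernel is again a
Gaussian, with integral `2πe` for every `lam`. -/
theorem lintegral_waveInt_sq_le_ball {a : ℝ} (ha : 0 < a) {lam : ℝ} (hlam : 0 < lam) (t : ℝ)
    {g : ℝ → ℂ} (hg : Integrable g) (hsupp : ∀ ξ, g ξ ≠ 0 → |ξ| ≤ lam) :
    ∫⁻ x, ‖waveInt a t g x‖ₑ ^ 2 ≤
      ENNReal.ofReal (2 * Real.pi * Real.exp 1) * ∫⁻ ξ, ‖g ξ‖ₑ ^ 2 := by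
  set b : ℝ := (lam ^ 2)⁻¹ with hb
  have hb0 : 0 < b := by positivity
  have hgauss : Integrable fun ξ : ℝ ↦ Real.exp 1 * Real.exp (-b * ξ ^ 2) :=
    (integrable_exp_neg_mul_sq hb0).const_mul _
  have hker : ∀ x, waveInt a 0 (fun ξ ↦ ((Real.exp 1 * Real.exp (-b * ξ ^ 2) : ℝ) : ℂ)) x =
      ((Real.exp 1 * (√(Real.pi / b) * Real.exp (-(4 * b)⁻¹ * x ^ 2)) : ℝ) : ℂ) := fun x ↦ by
    have h1 := fourierIntegral_gaussian (b := b) (by simpa using hb0) x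
    have h2 : ((Real.pi : ℂ) / b) ^ (1 / 2 : ℂ) = ((√(Real.pi / b) : ℝ) : ℂ) := by
      rw [Real.sqrt_eq_rpow, Complex.ofReal_cpow (by positivity)]
      push_cast; rfl
    rw [h2] at h1
    rw [waveInt, Complex.ofReal_mul, Complex.ofReal_mul (√(Real.pi / b))]
    have h3 : ((Real.exp (-(4 * b)⁻¹ * x ^ 2) : ℝ) : ℂ) =
        Complex.exp (-(x : ℂ) ^ 2 / (4 * b)) := by
      push_cast; congr 1; field_simp
    rw [h3, ← h1, ← integral_const_mul]
    refine integral_congr_ae (.of_forall fun ξ ↦ ?_)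
    simp only [wave_eq_exp]
    push_cast
    ring_nf
  have hGi : Integrable fun x : ℝ ↦
      Real.exp 1 * (√(Real.pi / b) * Real.exp (-(4 * b)⁻¹ * x ^ 2)) :=
    ((integrable_exp_neg_mul_sq (by positivity)).const_mul _).const_mul _
  refine lintegral_waveInt_sq_le ha (τ := fun _ ↦ t) (fun ξ ↦ by positivity) hgauss
    (G := fun x ↦ ENNReal.ofReal (Real.exp 1 * (√(Real.pi / b) * Real.exp (-(4 * b)⁻¹ * x ^ 2))))
    (by fun_prop) (fun x ↦ by simp) measurable_const (fun x y ↦ ?_) ?_ ?_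
    ENNReal.ofReal_ne_top hg (fun ξ hξ ↦ ?_)
  · rw [sub_self, hker, ← ofReal_norm, Complex.norm_real, Real.norm_of_nonneg (by positivity)]
  · rw [← ofReal_integral_eq_lintegral_ofReal hGi (.of_forall fun x ↦ by positivity),
      integral_const_mul, integral_const_mul, integral_gaussian, ← Real.sqrt_mul (by positivity)]
    refine ENNReal.ofReal_le_ofReal (le_of_eq ?_)
    have : Real.pi / b * (Real.pi / (4 * b)⁻¹) = (2 * Real.pi) ^ 2 := by field_simp; norm_num
    rw [this, Real.sqrt_sq (by positivity)]
    ring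
  · exact (ENNReal.ofReal_pos.2 (by positivity)).ne'
  · rw [← Real.exp_add]
    refine Real.one_le_exp ?_
    have h1 : b * ξ ^ 2 ≤ 1 := by
      rw [hb, inv_mul_le_iff₀ (by positivity), mul_one, ← sq_abs]
      exact pow_le_pow_left₀ (abs_nonneg _) (hsupp ξ hξ) 2
    linarith

/-! ### The maximal function on the frequency side -/

/-- The maximal function `x ↦ sup_{t ∈ J} |waveInt a t g x|`. -/
noncomputable def waveSup (a : ℝ) (J : Set ℝ) (g : ℝ → ℂ) (x : ℝ) : ℝ≥0∞ :=
  ⨆ t ∈ J, ‖waveInt a t g x‖ₑ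

/-- A supremum of continuous functions is lower semicontinuous, even over an uncountable `J`. -/
theorem measurable_waveSup {a : ℝ} (ha : 0 < a) (J : Set ℝ) {g : ℝ → ℂ} (hg : Integrable g) :
    Measurable (waveSup a J g) := by
  refine (lowerSemicontinuous_biSup fun t _ ↦ Continuous.lowerSemicontinuous ?_).measurable
  have h := continuous_waveInt ha hg
  have h2 : Continuous fun x : ℝ ↦ (t, x) := by fun_prop
  exact (h.comp h2).enorm

theorem abs_sub_le_volume_real {J : Set ℝ} (hJ : J.OrdConnected) (hb : volume J ≠ ∞) {s t : ℝ}
    (hs : s ∈ J) (ht : t ∈ J) : |t - s| ≤ volume.real J := by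
  have h := measureReal_mono (hJ.uIcc_subset hs ht) hb
  rwa [Measure.real, Real.volume_interval, ENNReal.toReal_ofReal (abs_nonneg _)] at h

/-- Linearisation of the maximal function up to a factor `2`: `τ x` is the first point of a dense
sequence in `J` at which at least half of the supremum is attained. -/
theorem exists_measurable_waveSup_le {a : ℝ} (ha : 0 < a) {J : Set ℝ} (hJ : J.Nonempty) {g : ℝ → ℂ}
    (hg : Integrable g) : ∃ τ : ℝ → ℝ, Measurable τ ∧ (∀ x, τ x ∈ J) ∧
      ∀ x, waveSup a J g x ≤ 2 * ‖waveInt a (τ x) g x‖ₑ := by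
  classical
  have : Nonempty J := hJ.to_subtype
  set d : ℕ → J := TopologicalSpace.denseSeq J
  have hfin : ∀ x, waveSup a J g x ≠ ∞ := fun x ↦ by
    refine ne_top_of_le_ne_top (ENNReal.ofReal_ne_top (r := ∫ ξ, ‖g ξ‖))
      (iSup₂_le fun t _ ↦ ?_)
    rw [← ofReal_norm]
    exact ENNReal.ofReal_le_ofReal (norm_waveInt_le a t g x)
  have hex : ∀ x, ∃ n, waveSup a J g x ≤ 2 * ‖waveInt a (d n) g x‖ₑ := fun x ↦ by
    rcases eq_or_ne (waveSup a J g x) 0 with h0 | h0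
    · exact ⟨0, by rw [h0]; exact zero_le⟩
    · have hlt : waveSup a J g x / 2 < waveSup a J g x := ENNReal.half_lt_self h0 (hfin x)
      obtain ⟨t, htJ, ht⟩ := lt_biSup_iff.1 hlt
      have hc : Continuous fun t : J ↦ ‖waveInt a t g x‖ₑ := by
        have h := continuous_waveInt ha hg
        have h2 : Continuous fun t : J ↦ ((t : ℝ), x) := by fun_prop
        exact (h.comp h2).enorm
      have hopen : IsOpen {t : J | waveSup a J g x / 2 < ‖waveInt a t g x‖ₑ} :=
        isOpen_lt continuous_const hc
      obtain ⟨n, hn⟩ := (TopologicalSpace.denseRange_denseSeq J).exists_mem_open hopen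
        ⟨⟨t, htJ⟩, ht⟩
      refine ⟨n, ?_⟩
      rw [mul_comm]
      exact (ENNReal.div_le_iff (by simp) (by simp)).1 (le_of_lt hn)
  refine ⟨fun x ↦ d (Nat.find (hex x)), ?_, fun x ↦ (d _).2, fun x ↦ Nat.find_spec (hex x)⟩
  have hm : Measurable fun x ↦ Nat.find (hex x) := measurable_find hex fun n ↦
    measurableSet_le (measurable_waveSup ha J hg)
      ((measurable_waveInt_comp ha hg measurable_const).enorm.const_mul 2)
  exact (measurable_from_nat (f := fun n ↦ (d n : ℝ))).comp hm

theorem waveSup_empty (a : ℝ) (g : ℝ → ℂ) : waveSup a ∅ g = 0 := by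
  ext x; simp [waveSup]

theorem eLpNorm_two_le_of_lintegral_le {F : ℝ → ℝ≥0∞} {g : ℝ → ℂ} {c : ℝ} (hc : 0 ≤ c)
    (h : ∫⁻ x, F x ^ 2 ≤ ENNReal.ofReal (c ^ 2) * ∫⁻ ξ, ‖g ξ‖ₑ ^ 2) :
    eLpNorm F 2 volume ≤ ENNReal.ofReal c * eLpNorm g 2 volume := by
  have h1 := eLpNorm_nnreal_pow_eq_lintegral (f := F) (μ := volume) (p := 2) (by simp)
  have h2 := eLpNorm_nnreal_pow_eq_lintegral (f := g) (μ := volume) (p := 2) (by simp)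
  simp only [NNReal.coe_ofNat, ENNReal.rpow_ofNat, enorm_eq_self, ENNReal.coe_ofNat] at h1 h2
  rw [← h1, ← h2, ENNReal.ofReal_pow hc, ← mul_pow] at h
  exact (ENNReal.pow_le_pow_left_iff (by norm_num)).1 h

/-- The maximal estimate for frequencies in a dyadic annulus, with loss `(|J| lam ^ a) ^ (1/4)`. -/
theorem exists_eLpNorm_waveSup_le_annulus {a : ℝ} (ha : 0 < a) (ha1 : a ≠ 1) :
    ∃ C > 0, ∀ lam > 0, ∀ J : Set ℝ, J.OrdConnected → volume J ≠ ∞ →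
      1 ≤ volume.real J * lam ^ a → ∀ g : ℝ → ℂ, Integrable g →
      (∀ ξ, g ξ ≠ 0 → lam / 2 ≤ |ξ| ∧ |ξ| ≤ lam) →
      eLpNorm (waveSup a J g) 2 volume ≤
        ENNReal.ofReal (C * (volume.real J * lam ^ a) ^ (1 / 4 : ℝ)) * eLpNorm g 2 volume := by
  obtain ⟨C, hC, h⟩ := exists_lintegral_waveInt_sq_le_annulus ha ha1
  refine ⟨2 * √C, by positivity, fun lam hlam J hJ hb hM g hg hsupp ↦ ?_⟩
  have hM0 : 0 ≤ volume.real J * lam ^ a := by linarith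
  refine eLpNorm_two_le_of_lintegral_le (by positivity) ?_
  rcases J.eq_empty_or_nonempty with rfl | hne
  · simp [waveSup_empty]
  obtain ⟨τ, hτ, hτJ, hle⟩ := exists_measurable_waveSup_le ha hne hg
  have h1 := h lam hlam (volume.real J) measureReal_nonneg hM τ hτ
    (fun x y ↦ abs_sub_le_volume_real hJ hb (hτJ y) (hτJ x)) g hg hsupp
  have hconst : (2 * √C * (volume.real J * lam ^ a) ^ (1 / 4 : ℝ)) ^ 2 =
      2 ^ 2 * (C * √(volume.real J * lam ^ a)) := by
    rw [mul_pow, mul_pow, Real.sq_sqrt hC.le, Real.sqrt_eq_rpow, ← Real.rpow_natCast,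
      ← Real.rpow_natCast,
      ← Real.rpow_mul hM0]
    norm_num
    ring
  calc ∫⁻ x, waveSup a J g x ^ 2 ≤ ∫⁻ x, 2 ^ 2 * ‖waveInt a (τ x) g x‖ₑ ^ 2 := by
        refine lintegral_mono fun x ↦ ?_
        rw [← mul_pow]
        exact pow_le_pow_left₀ zero_le (hle x) 2
    _ = 2 ^ 2 * ∫⁻ x, ‖waveInt a (τ x) g x‖ₑ ^ 2 := lintegral_const_mul' _ _ (by simp)
    _ ≤ 2 ^ 2 * (ENNReal.ofReal (C * √(volume.real J * lam ^ a)) * ∫⁻ ξ, ‖g ξ‖ₑ ^ 2) := by gcongr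
    _ = _ := by
        rw [hconst, ENNReal.ofReal_mul (p := 2 ^ 2) (by norm_num), ← mul_assoc,
          ENNReal.ofReal_pow (by norm_num), ENNReal.ofReal_ofNat]

theorem sq_lintegral_le_measure_mul_lintegral_sq {α : Type*} [MeasurableSpace α] (μ : Measure α)
    {f : α → ℝ≥0∞} (hf : Measurable f) : (∫⁻ x, f x ∂μ) ^ 2 ≤ μ univ * ∫⁻ x, f x ^ 2 ∂μ := by
  have h : 2 * (∫⁻ x, f x ∂μ) ^ 2 ≤ 2 * (μ univ * ∫⁻ x, f x ^ 2 ∂μ) := by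
    calc 2 * (∫⁻ x, f x ∂μ) ^ 2 = ∫⁻ x, ∫⁻ y, 2 * (f x * f y) ∂μ ∂μ := by
          rw [sq, ← lintegral_mul_const _ hf, ← lintegral_const_mul _ (by fun_prop)]
          refine lintegral_congr fun x ↦ ?_
          rw [← lintegral_const_mul _ hf, ← lintegral_const_mul _ (by fun_prop)]
      _ ≤ ∫⁻ x, ∫⁻ y, (f x ^ 2 + f y ^ 2) ∂μ ∂μ :=
          lintegral_mono fun x ↦ lintegral_mono fun y ↦ ENNReal.two_mul_mul_le_sq_add_sq _ _
      _ = _ := by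
          simp_rw [lintegral_add_left measurable_const, lintegral_const]
          rw [lintegral_add_right _ measurable_const, lintegral_mul_const _ (by fun_prop),
            lintegral_const]
          ring
  exact (ENNReal.mul_le_mul_iff_right (by simp) (by simp)).1 h

theorem hasDerivAt_waveInt {a : ℝ} (ha : 0 < a) {g : ℝ → ℂ} (hg : Integrable g)
    (hga : Integrable fun ξ ↦ ((|ξ| ^ a : ℝ) : ℂ) * g ξ) (x t : ℝ) :
    HasDerivAt (fun s ↦ waveInt a s g x)
      (Complex.I * waveInt a t (fun ξ ↦ ((|ξ| ^ a : ℝ) : ℂ) * g ξ) x) t := by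
  have h := (hasDerivAt_integral_of_dominated_loc_of_deriv_le (μ := volume) (x₀ := t) (𝕜 := ℝ)
    (F := fun s ξ ↦ wave a s x ξ * g ξ)
    (F' := fun s ξ ↦ Complex.I * (wave a s x ξ * (((|ξ| ^ a : ℝ) : ℂ) * g ξ)))
    (bound := fun ξ ↦ ‖((|ξ| ^ a : ℝ) : ℂ) * g ξ‖) (s := univ) Filter.univ_mem
    (.of_forall fun s ↦ (integrable_wave_mul ha hg s x).aestronglyMeasurable)
    (integrable_wave_mul ha hg t x)
    ((integrable_wave_mul ha hga t x).const_mul _).aestronglyMeasurable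
    (.of_forall fun ξ s _ ↦ by simp [norm_wave]) hga.norm
    (.of_forall fun ξ s _ ↦ ?_)).2
  · rw [integral_const_mul] at h
    exact h
  · simp only [wave_eq_exp]
    have h1 : HasDerivAt (fun s : ℝ ↦ ((ξ * x + s * |ξ| ^ a : ℝ) : ℂ)) ((1 * |ξ| ^ a : ℝ) : ℂ) s :=
      (((hasDerivAt_id' s).mul_const (|ξ| ^ a)).const_add (ξ * x)).ofReal_comp
    refine ((h1.const_mul Complex.I).cexp.mul_const (g ξ)).congr_deriv ?_
    rw [one_mul]
    ring

/-- Sobolev embedding in time: the supremum is controlled by the value at one time and the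
integral of the time derivative. -/
theorem waveSup_le_add_setLIntegral {a : ℝ} (ha : 0 < a) {J : Set ℝ} (hJ : J.OrdConnected)
    {g : ℝ → ℂ} (hg : Integrable g) (hga : Integrable fun ξ ↦ ((|ξ| ^ a : ℝ) : ℂ) * g ξ)
    {t₀ : ℝ} (ht₀ : t₀ ∈ J) (x : ℝ) :
    waveSup a J g x ≤ ‖waveInt a t₀ g x‖ₑ +
      ∫⁻ s in J, ‖waveInt a s (fun ξ ↦ ((|ξ| ^ a : ℝ) : ℂ) * g ξ) x‖ₑ := by
  refine iSup₂_le fun t ht ↦ ?_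
  have hc : Continuous fun s ↦ Complex.I * waveInt a s (fun ξ ↦ ((|ξ| ^ a : ℝ) : ℂ) * g ξ) x := by
    have h1 := continuous_waveInt ha hga
    have h2 : Continuous fun s : ℝ ↦ (s, x) := by fun_prop
    exact continuous_const.mul (h1.comp h2)
  have hftc := intervalIntegral.integral_eq_sub_of_hasDerivAt (a := t₀) (b := t)
    (fun s _ ↦ hasDerivAt_waveInt ha hg hga x s) (hc.intervalIntegrable _ _)
  rw [← add_sub_cancel (waveInt a t₀ g x) (waveInt a t g x), ← hftc]
  refine (enorm_add_le _ _).trans (add_le_add le_rfl ?_)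
  have hn : ‖∫ s in t₀..t, Complex.I * waveInt a s (fun ξ ↦ ((|ξ| ^ a : ℝ) : ℂ) * g ξ) x‖ₑ =
      ‖∫ s in uIoc t₀ t, Complex.I * waveInt a s (fun ξ ↦ ((|ξ| ^ a : ℝ) : ℂ) * g ξ) x‖ₑ := by
    rw [← ofReal_norm, ← ofReal_norm, intervalIntegral.norm_intervalIntegral_eq]
  rw [hn]
  refine (enorm_integral_le_lintegral_enorm _).trans ?_
  have he : ∀ s, ‖Complex.I * waveInt a s (fun ξ ↦ ((|ξ| ^ a : ℝ) : ℂ) * g ξ) x‖ₑ =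
      ‖waveInt a s (fun ξ ↦ ((|ξ| ^ a : ℝ) : ℂ) * g ξ) x‖ₑ := fun s ↦ by
    rw [enorm_mul, ← ofReal_norm Complex.I, Complex.norm_I]; simp
  simp only [he]
  exact lintegral_mono_set (uIoc_subset_uIcc.trans (hJ.uIcc_subset ht₀ ht))

/-- The maximal estimate without loss when the time interval is at most as long as the period
`lam ^ (-a)`. The time derivative costs a factor `lam ^ a`, the integral over `J` gains `|J|`. -/
theorem eLpNorm_waveSup_le_of_mul_rpow_le_one {a : ℝ} (ha : 0 < a) {lam : ℝ} (hlam : 0 < lam)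
    {J : Set ℝ} (hJ : J.OrdConnected) (hb : volume J ≠ ∞) (hM : volume.real J * lam ^ a ≤ 1)
    {g : ℝ → ℂ} (hg : Integrable g) (hsupp : ∀ ξ, g ξ ≠ 0 → |ξ| ≤ lam) :
    eLpNorm (waveSup a J g) 2 volume ≤
      ENNReal.ofReal √(8 * Real.pi * Real.exp 1) * eLpNorm g 2 volume := by
  refine eLpNorm_two_le_of_lintegral_le (by positivity) ?_
  rcases J.eq_empty_or_nonempty with rfl | ⟨t₀, ht₀⟩
  · simp [waveSup_empty]
  set gₐ : ℝ → ℂ := fun ξ ↦ ((|ξ| ^ a : ℝ) : ℂ) * g ξ with hgₐ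
  have hgₐle : ∀ ξ, ‖gₐ ξ‖ ≤ lam ^ a * ‖g ξ‖ := fun ξ ↦ by
    rw [hgₐ]
    rcases eq_or_ne (g ξ) 0 with h0 | h0
    · simp [h0]
    · rw [norm_mul, Complex.norm_real, Real.norm_of_nonneg (by positivity)]
      gcongr
      exact hsupp ξ h0
  have hcont : Continuous fun ξ : ℝ ↦ ((|ξ| ^ a : ℝ) : ℂ) :=
    Complex.continuous_ofReal.comp (continuous_abs.rpow_const fun _ ↦ Or.inr ha.le)
  have hga : Integrable gₐ :=
    Integrable.mono' (hg.norm.const_mul (lam ^ a))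
      (hcont.aestronglyMeasurable.mul hg.aestronglyMeasurable) (.of_forall hgₐle)
  have hsuppa : ∀ ξ, gₐ ξ ≠ 0 → |ξ| ≤ lam := fun ξ h ↦ hsupp ξ fun h0 ↦ h (by simp [hgₐ, h0])
  set P : ℝ≥0∞ := ENNReal.ofReal (2 * Real.pi * Real.exp 1) with hP
  set A : ℝ≥0∞ := ∫⁻ ξ, ‖g ξ‖ₑ ^ 2 with hA
  have hsqa : ∫⁻ ξ, ‖gₐ ξ‖ₑ ^ 2 ≤ ENNReal.ofReal (lam ^ a) ^ 2 * A := by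
    rw [hA, ← lintegral_const_mul' _ _ (by simp)]
    refine lintegral_mono fun ξ ↦ ?_
    rw [← mul_pow, ← ofReal_norm, ← ofReal_norm, ← ENNReal.ofReal_mul (by positivity)]
    exact pow_le_pow_left₀ zero_le (ENNReal.ofReal_le_ofReal (hgₐle ξ)) 2
  have hjoint : Measurable fun p : ℝ × ℝ ↦ ‖waveInt a p.2 gₐ p.1‖ₑ := by
    have h1 := (continuous_waveInt ha hga).comp continuous_swap
    exact h1.enorm.measurable
  have hVM : volume J * ENNReal.ofReal (lam ^ a) ≤ 1 := by
    rw [← ENNReal.ofReal_toReal hb, ← ENNReal.ofReal_mul ENNReal.toReal_nonneg,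
      ← ENNReal.ofReal_one]
    exact ENNReal.ofReal_le_ofReal hM
  have hsecond : ∫⁻ x, (∫⁻ s in J, ‖waveInt a s gₐ x‖ₑ) ^ 2 ≤ P * A := by
    calc ∫⁻ x, (∫⁻ s in J, ‖waveInt a s gₐ x‖ₑ) ^ 2
        ≤ ∫⁻ x, volume J * ∫⁻ s in J, ‖waveInt a s gₐ x‖ₑ ^ 2 := by
          refine lintegral_mono fun x ↦ ?_
          have h := sq_lintegral_le_measure_mul_lintegral_sq (volume.restrict J)
            (hjoint.comp (by fun_prop : Measurable fun s : ℝ ↦ (x, s)))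
          rwa [Measure.restrict_apply_univ] at h
      _ = volume J * ∫⁻ s in J, ∫⁻ x, ‖waveInt a s gₐ x‖ₑ ^ 2 := by
          rw [lintegral_const_mul' _ _ hb,
            lintegral_lintegral_swap (hjoint.pow_const 2).aemeasurable]
      _ ≤ volume J * ∫⁻ s in J, P * (ENNReal.ofReal (lam ^ a) ^ 2 * A) := by
          gcongr with s
          exact (lintegral_waveInt_sq_le_ball ha hlam s hga hsuppa).trans (by gcongr)
      _ = (volume J * ENNReal.ofReal (lam ^ a)) ^ 2 * (P * A) := by
          rw [setLIntegral_const]; ring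
      _ ≤ 1 ^ 2 * (P * A) := by gcongr
      _ = P * A := by ring
  calc ∫⁻ x, waveSup a J g x ^ 2
      ≤ ∫⁻ x, (2 * ‖waveInt a t₀ g x‖ₑ ^ 2 + 2 * (∫⁻ s in J, ‖waveInt a s gₐ x‖ₑ) ^ 2) := by
        refine lintegral_mono fun x ↦ ?_
        refine (pow_le_pow_left₀ zero_le
          (waveSup_le_add_setLIntegral ha hJ hg hga ht₀ x) 2).trans ?_
        rw [add_sq, two_mul (‖waveInt a t₀ g x‖ₑ ^ 2), two_mul (_ ^ 2)]
        have := ENNReal.two_mul_mul_le_sq_add_sq ‖waveInt a t₀ g x‖ₑ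
          (∫⁻ s in J, ‖waveInt a s gₐ x‖ₑ)
        rw [← mul_assoc] at this
        refine (add_le_add (add_le_add le_rfl this) le_rfl).trans_eq ?_
        ring
    _ = 2 * (∫⁻ x, ‖waveInt a t₀ g x‖ₑ ^ 2) +
          2 * ∫⁻ x, (∫⁻ s in J, ‖waveInt a s gₐ x‖ₑ) ^ 2 := by
        rw [lintegral_add_left
          (((measurable_waveInt_comp ha hg measurable_const).enorm.pow_const 2).const_mul 2),
          lintegral_const_mul' _ _ (by simp), lintegral_const_mul' _ _ (by simp)]
    _ ≤ 2 * (P * A) + 2 * (P * A) := by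
        gcongr
        exact lintegral_waveInt_sq_le_ball ha hlam t₀ hg hsupp
    _ = _ := by
        rw [Real.sq_sqrt (by positivity), show 8 * Real.pi * Real.exp 1 =
          4 * (2 * Real.pi * Real.exp 1) by ring, ENNReal.ofReal_mul (by norm_num)]
        rw [← hP, ENNReal.ofReal_ofNat]
        ring

theorem waveSup_add_le {a : ℝ} (ha : 0 < a) (J : Set ℝ) {g₁ g₂ : ℝ → ℂ} (h₁ : Integrable g₁)
    (h₂ : Integrable g₂) (x : ℝ) :
    waveSup a J (g₁ + g₂) x ≤ waveSup a J g₁ x + waveSup a J g₂ x := by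
  refine iSup₂_le fun t ht ↦ ?_
  have : waveInt a t (g₁ + g₂) x = waveInt a t g₁ x + waveInt a t g₂ x := by
    simp only [waveInt, Pi.add_apply, mul_add]
    exact integral_add (integrable_wave_mul ha h₁ t x) (integrable_wave_mul ha h₂ t x)
  rw [this]
  exact (enorm_add_le _ _).trans (add_le_add (le_iSup₂ (f := fun t _ ↦ ‖waveInt a t g₁ x‖ₑ) t ht)
    (le_iSup₂ (f := fun t _ ↦ ‖waveInt a t g₂ x‖ₑ) t ht))

/-- The maximal estimate for `|ξ| ≤ lam`, by induction on the number of dyadic annuli above the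
frequency at which `|J| lam ^ a = 1`. The annuli contribute a geometric series: halving `lam`
multiplies `(|J| lam ^ a) ^ (1/4)` by a factor `q < 1`, and `C₂ = C₃ / (1 - q)` is the sum of that
series. -/
theorem exists_eLpNorm_waveSup_le {a : ℝ} (ha : 0 < a) (ha1 : a ≠ 1) :
    ∃ C > 0, ∀ lam > 0, ∀ J : Set ℝ, J.OrdConnected → volume J ≠ ∞ → ∀ g : ℝ → ℂ, Integrable g →
      (∀ ξ, g ξ ≠ 0 → |ξ| ≤ lam) →
      eLpNorm (waveSup a J g) 2 volume ≤
        ENNReal.ofReal (C * ((volume.real J * lam ^ a) ^ (1 / 4 : ℝ) + 1)) *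
          eLpNorm g 2 volume := by
  obtain ⟨C₃, hC₃, hann⟩ := exists_eLpNorm_waveSup_le_annulus ha ha1
  set C₁ := √(8 * Real.pi * Real.exp 1) with hC₁
  have hC₁0 : 0 ≤ C₁ := Real.sqrt_nonneg _
  have h2a : 1 < (2 : ℝ) ^ a := Real.one_lt_rpow (by norm_num) ha
  set q : ℝ := (((2 : ℝ) ^ a)⁻¹) ^ (1 / 4 : ℝ) with hq
  have hq1 : q < 1 := Real.rpow_lt_one (by positivity) (inv_lt_one_of_one_lt₀ h2a) (by norm_num)
  have hq0 : 0 < q := by positivity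
  set C₂ := C₃ / (1 - q) with hC₂
  have hC₂0 : 0 < C₂ := div_pos hC₃ (by linarith)
  have hC₂eq : C₂ * q + C₃ = C₂ := by
    have : 1 - q ≠ 0 := by linarith
    rw [hC₂]; field_simp; ring
  have key : ∀ n : ℕ, ∀ lam > 0, ∀ J : Set ℝ, J.OrdConnected → volume J ≠ ∞ →
      volume.real J * lam ^ a ≤ ((2 : ℝ) ^ a) ^ n → ∀ g : ℝ → ℂ, Integrable g →
      (∀ ξ, g ξ ≠ 0 → |ξ| ≤ lam) → eLpNorm (waveSup a J g) 2 volume ≤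
        ENNReal.ofReal (C₁ + C₂ * (volume.real J * lam ^ a) ^ (1 / 4 : ℝ)) *
          eLpNorm g 2 volume := by
    intro n
    induction n with
    | zero =>
      intro lam hlam J hJ hb hM g hg hsupp
      rw [pow_zero] at hM
      have : 0 ≤ volume.real J * lam ^ a := by positivity
      refine (eLpNorm_waveSup_le_of_mul_rpow_le_one ha hlam hJ hb hM hg hsupp).trans ?_
      gcongr
      exact le_add_of_nonneg_right (by positivity)
    | succ n ih =>
      intro lam hlam J hJ hb hM g hg hsupp
      have hM0 : 0 ≤ volume.real J * lam ^ a := by positivity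
      rcases le_or_gt (volume.real J * lam ^ a) 1 with hle | hgt
      · refine (eLpNorm_waveSup_le_of_mul_rpow_le_one ha hlam hJ hb hle hg hsupp).trans ?_
        gcongr
        exact le_add_of_nonneg_right (by positivity)
      · set S : Set ℝ := Metric.closedBall 0 (lam / 2) with hS
        have hSm : MeasurableSet S := Metric.isClosed_closedBall.measurableSet
        have hmemS : ∀ ξ, ξ ∈ S ↔ |ξ| ≤ lam / 2 := fun ξ ↦ by simp [hS]
        have hhalf : volume.real J * (lam / 2) ^ a =
            (volume.real J * lam ^ a) * ((2 : ℝ) ^ a)⁻¹ := by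
          rw [Real.div_rpow hlam.le (by norm_num)]; ring
        have hlow := ih (lam / 2) (by positivity) J hJ hb
          (by
            rw [hhalf, ← div_eq_mul_inv, div_le_iff₀ (by positivity), ← pow_succ]
            exact hM)
          (S.indicator g) (hg.indicator hSm)
          (fun ξ hξ ↦ (hmemS ξ).1 (mem_of_indicator_ne_zero hξ))
        have hhigh := hann lam hlam J hJ hb hgt.le (Sᶜ.indicator g) (hg.indicator hSm.compl)
          (fun ξ hξ ↦ by
            have h1 : ξ ∉ S := mem_of_indicator_ne_zero hξ
            rw [hmemS] at h1
            refine ⟨by linarith, hsupp ξ fun h0 ↦ hξ ?_⟩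
            rw [indicator_of_mem (show ξ ∈ Sᶜ from mem_of_indicator_ne_zero hξ), h0])
        have hsum : S.indicator g + Sᶜ.indicator g = g := indicator_self_add_compl S g
        calc eLpNorm (waveSup a J g) 2 volume
            ≤ eLpNorm (waveSup a J (S.indicator g) + waveSup a J (Sᶜ.indicator g)) 2 volume := by
              refine eLpNorm_mono_enorm fun x ↦ ?_
              have := waveSup_add_le ha J (hg.indicator hSm) (hg.indicator hSm.compl) x
              rw [hsum] at this
              simpa using this
          _ ≤ eLpNorm (waveSup a J (S.indicator g)) 2 volume +
                eLpNorm (waveSup a J (Sᶜ.indicator g)) 2 volume :=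
              eLpNorm_add_le
                (measurable_waveSup ha J (hg.indicator hSm)).aestronglyMeasurable
                (measurable_waveSup ha J (hg.indicator hSm.compl)).aestronglyMeasurable
                (by norm_num)
          _ ≤ _ := add_le_add hlow hhigh
          _ ≤ ENNReal.ofReal (C₁ + C₂ * (volume.real J * (lam / 2) ^ a) ^ (1 / 4 : ℝ)) *
                eLpNorm g 2 volume +
              ENNReal.ofReal (C₃ * (volume.real J * lam ^ a) ^ (1 / 4 : ℝ)) *
                eLpNorm g 2 volume := by
              gcongr <;> exact eLpNorm_indicator_le _
          _ = _ := by
              rw [← add_mul, ← ENNReal.ofReal_add (by positivity) (by positivity), hhalf,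
                Real.mul_rpow hM0 (by positivity), ← hq]
              congr 2
              linear_combination (volume.real J * lam ^ a) ^ (1 / 4 : ℝ) * hC₂eq
  refine ⟨C₁ + C₂, by positivity, fun lam hlam J hJ hb g hg hsupp ↦ ?_⟩
  have hM0 : 0 ≤ volume.real J * lam ^ a := by positivity
  obtain ⟨n, hn⟩ := pow_unbounded_of_one_lt (volume.real J * lam ^ a) h2a
  refine (key n lam hlam J hJ hb hn.le g hg hsupp).trans ?_
  gcongr
  have : 0 ≤ (volume.real J * lam ^ a) ^ (1 / 4 : ℝ) := by positivity
  nlinarith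

/-! ### Transfer to the Fourier transform on `L²` -/

theorem fourierHat_eq_comp (f : Lp ℂ 2 (volume : Measure ℝ)) :
    fourierHat f = (𝓕 f : Lp ℂ 2 (volume : Measure ℝ)) ∘ ((2 * Real.pi)⁻¹ * ·) := by
  ext ξ
  rw [fourierHat, div_eq_inv_mul, Function.comp_apply]

theorem map_volume_inv_two_pi_mul : Measure.map ((2 * Real.pi)⁻¹ * ·) (volume : Measure ℝ) =
    ENNReal.ofReal (2 * Real.pi) • volume := by
  rw [Real.map_volume_mul_left (by positivity), inv_inv, abs_of_pos (by positivity)]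

theorem aestronglyMeasurable_fourierTransform_map (f : Lp ℂ 2 (volume : Measure ℝ)) :
    AEStronglyMeasurable (𝓕 f : Lp ℂ 2 (volume : Measure ℝ))
      (Measure.map ((2 * Real.pi)⁻¹ * ·) (volume : Measure ℝ)) := by
  rw [map_volume_inv_two_pi_mul]
  exact (Lp.aestronglyMeasurable _).smul_measure _

theorem aestronglyMeasurable_fourierHat (f : Lp ℂ 2 (volume : Measure ℝ)) :
    AEStronglyMeasurable (fourierHat f) volume := by
  rw [fourierHat_eq_comp]
  exact (aestronglyMeasurable_fourierTransform_map f).comp_aemeasurable (by fun_prop)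

/-- Plancherel's theorem in the normalisation of `fourierHat`. -/
theorem eLpNorm_fourierHat (f : Lp ℂ 2 (volume : Measure ℝ)) :
    eLpNorm (fourierHat f) 2 volume = ENNReal.ofReal (√(2 * Real.pi) * ‖f‖) := by
  rw [fourierHat_eq_comp, ← eLpNorm_map_measure (aestronglyMeasurable_fourierTransform_map f)
    (by fun_prop), map_volume_inv_two_pi_mul, eLpNorm_smul_measure_of_ne_top (by norm_num),
    ENNReal.ofReal_mul (Real.sqrt_nonneg _), Real.sqrt_eq_rpow, ← Lp.norm_fourier_eq f, Lp.norm_def,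
    ENNReal.ofReal_toReal (Lp.eLpNorm_ne_top _),
    ← ENNReal.ofReal_rpow_of_nonneg (by positivity) (by norm_num), smul_eq_mul]
  norm_num

/-- The union of the open sets in the definition of `essSupp` is possibly uncountable; it is still a
set where `g` vanishes almost everywhere because `ℝ` is second countable. -/
theorem ae_eq_zero_of_notMem_closedBall {g : ℝ → ℂ} {lam : ℝ}
    (h : essSupp g ⊆ Metric.closedBall 0 lam) :
    ∀ᵐ ξ, ξ ∉ Metric.closedBall (0 : ℝ) lam → g ξ = 0 := by
  rw [ae_iff]
  refine measure_null_of_locally_null _ fun ξ hξ ↦ ?_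
  have h1 : ξ ∉ essSupp g := fun hs ↦ hξ fun hn ↦ absurd (h hs) hn
  simp only [essSupp, mem_ofPred_eq, not_forall, not_not] at h1
  obtain ⟨U, hU, hz⟩ := h1
  refine ⟨{η | ¬g η = 0} ∩ U, ?_, ?_⟩
  · filter_upwards [self_mem_nhdsWithin, mem_nhdsWithin_of_mem_nhds hU] with η h2 h3
    exact ⟨fun h4 ↦ h2 fun _ ↦ h4, h3⟩
  · exact le_antisymm ((Measure.le_restrict_apply _ _).trans_eq (ae_iff.1 hz)) zero_le

theorem schrodingerMaximal_eq (a : ℝ) (J : Set ℝ) (f : Lp ℂ 2 (volume : Measure ℝ)) (x : ℝ) :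
    schrodingerMaximal a J f x = ‖(2 * (Real.pi : ℂ))⁻¹‖ₑ * waveSup a J (fourierHat f) x := by
  simp only [schrodingerMaximal, waveSup, ENNReal.mul_iSup, ← enorm_mul]
  rfl

theorem waveSup_congr_ae (a : ℝ) (J : Set ℝ) {g₁ g₂ : ℝ → ℂ} (h : g₁ =ᵐ[volume] g₂) :
    waveSup a J g₁ = waveSup a J g₂ := by
  ext x
  have : ∀ t, waveInt a t g₁ x = waveInt a t g₂ x := fun t ↦
    integral_congr_ae (h.mono fun ξ hξ ↦ by simp only [hξ])
  simp only [waveSup, this]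

theorem theorem2 (a : ℝ) (ha : 0 < a) (ha1 : a ≠ 1) :
    ∃ C : ℝ, 0 < C ∧
      ∀ (lam : ℝ), 1 ≤ lam →
      ∀ (J : Set ℝ), J.OrdConnected → J ⊆ Set.Icc 0 1 →
      ∀ (f : Lp ℂ 2 (volume : Measure ℝ)),
        essSupp (fourierHat f) ⊆ Metric.closedBall 0 lam →
        Measurable (schrodingerMaximal a J f) ∧
        eLpNorm (schrodingerMaximal a J f) 2 volume ≤
          ENNReal.ofReal
            (C * ((volume.real J) ^ (1 / 4 : ℝ) * lam ^ (a / 4) + 1) * ‖f‖) := by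
  obtain ⟨C, hC, h⟩ := exists_eLpNorm_waveSup_le ha ha1
  refine ⟨C * √(2 * Real.pi), by positivity, fun lam hlam J hJ hJ1 f hf ↦ ?_⟩
  have hlam0 : 0 < lam := by linarith
  have hb : volume J ≠ ∞ := measure_ne_top_of_subset hJ1 measure_Icc_lt_top.ne
  set B := Metric.closedBall (0 : ℝ) lam with hB
  have hBm : MeasurableSet B := Metric.isClosed_closedBall.measurableSet
  have hae : B.indicator (fourierHat f) =ᵐ[volume] fourierHat f := by
    filter_upwards [ae_eq_zero_of_notMem_closedBall hf] with ξ hξ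
    by_cases hm : ξ ∈ B
    · exact indicator_of_mem hm _
    · rw [indicator_of_notMem hm, hξ hm]
  have hmem : MemLp (fourierHat f) 2 volume :=
    ⟨aestronglyMeasurable_fourierHat f, eLpNorm_fourierHat f ▸ ENNReal.ofReal_lt_top⟩
  have hint : Integrable (B.indicator (fourierHat f)) := by
    have : Fact (volume B < ∞) := ⟨measure_closedBall_lt_top⟩
    exact (integrable_indicator_iff hBm).2 ((hmem.restrict B).integrable (by norm_num))
  have heq := waveSup_congr_ae a J hae
  have hfun : schrodingerMaximal a J f =
      fun x ↦ ‖(2 * (Real.pi : ℂ))⁻¹‖ₑ * waveSup a J (B.indicator (fourierHat f)) x := by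
    ext x; rw [schrodingerMaximal_eq, heq]
  refine ⟨?_, ?_⟩
  · rw [hfun]
    exact (measurable_waveSup ha J hint).const_mul _
  have hnorm : ‖(2 * (Real.pi : ℂ))⁻¹‖ₑ ≤ 1 := by
    rw [← ofReal_norm, ← ENNReal.ofReal_one]
    refine ENNReal.ofReal_le_ofReal ?_
    rw [norm_inv, norm_mul, Complex.norm_real, Real.norm_of_nonneg Real.pi_pos.le]
    refine inv_le_one_of_one_le₀ ?_
    have := Real.pi_gt_three
    norm_num
    linarith
  calc eLpNorm (schrodingerMaximal a J f) 2 volume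
      ≤ eLpNorm (waveSup a J (B.indicator (fourierHat f))) 2 volume := by
        refine eLpNorm_mono_enorm fun x ↦ ?_
        rw [hfun]
        simpa using mul_le_mul_left hnorm (waveSup a J (B.indicator (fourierHat f)) x)
    _ ≤ ENNReal.ofReal (C * ((volume.real J * lam ^ a) ^ (1 / 4 : ℝ) + 1)) *
          eLpNorm (B.indicator (fourierHat f)) 2 volume := by
        refine h lam hlam0 J hJ hb _ hint fun ξ hξ ↦ ?_
        simpa [hB] using mem_of_indicator_ne_zero hξ
    _ ≤ ENNReal.ofReal (C * ((volume.real J * lam ^ a) ^ (1 / 4 : ℝ) + 1)) *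
          ENNReal.ofReal (√(2 * Real.pi) * ‖f‖) := by
        rw [← eLpNorm_fourierHat]
        gcongr
        exact eLpNorm_indicator_le _
    _ = _ := by
        have hM : 0 ≤ volume.real J := measureReal_nonneg
        rw [← ENNReal.ofReal_mul (by positivity), Real.mul_rpow hM (by positivity),
          ← Real.rpow_mul hlam0.le]
        congr 1
        ring_nf
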